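/- Throughout, $\mathrm{He}_k$ is the $k$-th (probabilists') Hermite polynomial and $\mathcal O_P$ is the group of orthogonal $P\times P$ matrices. **Leap.** Let $h_*:\mathbb R^P\to\mathbb R$ be a polynomial. For $R\in\mathcal O_P$ write $h_*(z)=\sum_{S\in\mathbb Z_{\ge 0}^P}\hat h_R(S)\prod_{i=1}^P \mathrm{He}_{S(i)}((Rz)_i)$ and let $\{S_1,\dots,S_m\}$ be the set of $S$ with $\hat h_R(S)\neq 0$. Define $$\mathrm{Leap}(h_*,R)=\min_{\pi\in\Pi_m}\max_{i\in[m]}\ \sum_{k=1}^P S_{\pi(i)}(k)\,\mathbf 1\{S_{\pi(j)}(k)=0\ \ \forall j<i\},\qquad \mathrm{isoLeap}(h_*)=\max_{R\in\mathcal O_P}\mathrm{Leap}(h_*,R),$$ where $\Pi_m$ is the set of permutations of $[m]$. **CSQ algorithms.** A CSQ algorithm on $\mathbb R^d$ with $n$ queries of tolerance $\tau$ adaptively asks $n$ measurable queries $\phi_t:\mathbb R^d\to[-1,1]$ (each may depend on the previous responses); for a target $f_*$ the response to $\phi_t$ may be any number in $\mathbb E_{x\sim\mathsf N(0,I_d)}[\phi_t(x)f_*(x)]+[-\tau,\tau]$.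 From the $n$ responses it outputs a measurable function $\hat f:\mathbb R^d\to\mathbb R$. It learns $f_*$ to error below $c$ if $\mathbb E_{x\sim\mathsf N(0,I_d)}[(f_*(x)-\hat f(x))^2]<c$ for every admissible sequence of responses. **Proposition.** Let $P\ge 0$. (i) Let $h_*:\mathbb R^P\to\mathbb R$ be a polynomial of degree $D\ge 1$. There are constants $c_{h_*},C_{h_*}>0$, depending only on $h_*$, such that the following holds for all $d\ge P$, $n\ge 0$ and $\tau>0$ with $\tau^2\le n$ (in particular whenever $n\ge1$ and $0<\tau\le1$). Let $M\in\mathbb R^{P\times d}$ be uniformly random among the matrices with $MM^\top=I_P$, that is, distributed as the first $P$ rows of a Haar-random $d\times d$ orthogonal matrix, and let $f_{*,M}(x)=h_*(Mx)$. Then for every CSQ algorithm on $\mathbb R^d$ with $n$ queries of tolerance $\tau$, the (outer) probability over $M$ that it learns $f_{*,M}$ to error below $c_{h_*}$ is at most $$\frac{C_{h_*}\,n}{\tau^2}\,d^{-\mathrm{isoLeap}(h_*)/2}.$$ Equivalently, with probability at least $1-\frac{C_{h_*}n}{\tau^2}d^{-\mathrm{isoLeap}(h_*)/2}$ over $M$,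 for some admissible sequence of responses the output satisfies $\mathbb E_{x\sim\mathsf N(0,I_d)}[(f_{*,M}(x)-\hat f(x))^2]\ge c_{h_*}>0$. (ii) For every $\alpha\in\mathbb Z_{\ge 0}^P$ there is $C_\alpha>0$, depending only on $P$ and $\alpha$, such that for all $d\ge P$ and $R$ Haar-distributed on $\mathcal O_d$, with $\mathrm{He}_\alpha(y)=\prod_{i=1}^P\mathrm{He}_{\alpha_i}(y_i)$ for $y\in\mathbb R^d$ and $|\alpha|=\sum_i\alpha_i$, $$\sup_{\phi\in L^2(\mathsf N(0,I_d)),\ \|\phi\|=1}\ \mathbb E_R\Big[\big(\mathbb E_{x\sim\mathsf N(0,I_d)}[\mathrm{He}_\alpha(Rx)\,\phi(x)]\big)^2\Big]\le C_\alpha\, d^{-\lceil|\alpha|/2\rceil}.$$ -/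

import Mathlib

open MeasureTheory ProbabilityTheory

/-! ### Gaussian inputs and Hermite expansions -/

/-- The standard Gaussian measure `N(0, I_d)` on `ℝ^d`. -/
noncomputable def stdGauss (d : ℕ) : Measure (Fin d → ℝ) :=
  Measure.pi fun _ => gaussianReal 0 1

/-- The product `z ↦ ∏ i, He_{S i}(z i)` of probabilists' Hermite polynomials. -/
noncomputable def hermiteProd {P : ℕ} (S : Fin P → ℕ) (z : Fin P → ℝ) : ℝ :=
  ∏ i, Polynomial.aeval (z i) (Polynomial.hermite (S i))

/-- The coefficient of `z ↦ hermiteProd S (R z)` in the expansion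
`h(z) = ∑ S, ĥ_R(S) ∏ i, He_{S i}((R z) i)` of the polynomial `h` in the orthogonal basis of
`L²(N(0, I_P))` attached to the axes given by the rows of `R`. -/
noncomputable def hermiteCoeff {P : ℕ} (h : MvPolynomial (Fin P) ℝ)
    (R : Matrix.orthogonalGroup (Fin P) ℝ) (S : Fin P → ℕ) : ℝ :=
  (∫ z, MvPolynomial.eval z h * hermiteProd S ((R : Matrix (Fin P) (Fin P) ℝ).mulVec z)
    ∂(stdGauss P)) / ∏ i, ((S i).factorial : ℝ)

/-! ### Leap and isotropic leap -/

/-- For an enumeration `π` of multi-indices, the number of new coordinates (with multiplicity)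
that `π i` brings: the sum of `π i k` over the `k` at which all earlier `π j` vanish. -/
def leapIncrement {P m : ℕ} (π : Fin m → Fin P → ℕ) (i : Fin m) : ℕ :=
  ∑ k, if ∀ j < i, π j k = 0 then π i k else 0

/-- The leap of a finite set of multi-indices: the minimum over all its enumerations
`π 0, …, π (m - 1)` without repetition of the largest increment. -/
noncomputable def leapOf {P : ℕ} (𝒮 : Set (Fin P → ℕ)) : ℕ :=
  sInf {l | ∃ (m : ℕ) (π : Fin m → Fin P → ℕ), Function.Injective π ∧ Set.range π = 𝒮 ∧
    l = Finset.univ.sup (leapIncrement π)}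

/-- `Leap(h, R)`, the leap of the set of nonzero Hermite coefficients of `h` in the axes `R`. -/
noncomputable def leap {P : ℕ} (h : MvPolynomial (Fin P) ℝ)
    (R : Matrix.orthogonalGroup (Fin P) ℝ) : ℕ :=
  leapOf {S | hermiteCoeff h R S ≠ 0}

/-- `isoLeap(h)`, the maximum of `Leap(h, R)` over `R ∈ O(P)`; it exists, because
`Leap(h, R)` is at most the degree of `h`. -/
noncomputable def isoLeap {P : ℕ} (h : MvPolynomial (Fin P) ℝ) : ℕ :=
  ⨆ R : Matrix.orthogonalGroup (Fin P) ℝ, leap h R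

/-! ### Haar measure on `O(d)` and uniform semi-orthogonal matrices -/

instance matrixMeasurableSpace (m n : ℕ) : MeasurableSpace (Matrix (Fin m) (Fin n) ℝ) :=
  MeasurableSpace.pi

instance matrixBorelSpace (m n : ℕ) : BorelSpace (Matrix (Fin m) (Fin n) ℝ) :=
  inferInstanceAs (BorelSpace (Fin m → Fin n → ℝ))

instance orthogonalGroupCompact (d : ℕ) : CompactSpace (Matrix.orthogonalGroup (Fin d) ℝ) := by
  have hclosed : IsClosed
      ((Matrix.orthogonalGroup (Fin d) ℝ : Set (Matrix (Fin d) (Fin d) ℝ))) := by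
    have heq : ((Matrix.orthogonalGroup (Fin d) ℝ : Set (Matrix (Fin d) (Fin d) ℝ)))
        = {A | A * star A = 1} := by
      ext A
      exact Matrix.mem_orthogonalGroup_iff (Fin d) ℝ
    rw [heq]
    exact isClosed_eq (by fun_prop) continuous_const
  have hbox : IsCompact (Set.pi Set.univ fun _ : Fin d =>
      Set.pi Set.univ fun _ : Fin d => Set.Icc (-1 : ℝ) 1) :=
    isCompact_univ_pi fun _ => isCompact_univ_pi fun _ => isCompact_Icc
  refine isCompact_iff_compactSpace.mp (IsCompact.of_isClosed_subset hbox hclosed ?_)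
  intro A hA i _ j _
  exact abs_le.mp (entry_norm_bound_of_unitary (𝕜 := ℝ) hA i j)

/-- The Haar probability measure on the orthogonal group `O(d)`. -/
noncomputable def haarOrthogonal (d : ℕ) : Measure (Matrix.orthogonalGroup (Fin d) ℝ) :=
  Measure.haarMeasure ⊤

instance haarOrthogonal_isProbabilityMeasure (d : ℕ) :
    IsProbabilityMeasure (haarOrthogonal d) :=
  ⟨by
    have h := Measure.haarMeasure_self
      (K₀ := (⊤ : TopologicalSpace.PositiveCompacts (Matrix.orthogonalGroup (Fin d) ℝ)))
    simpa [haarOrthogonal] using h⟩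

/-- The first `P` rows of an orthogonal `d × d` matrix. -/
def firstRows {P d : ℕ} (hPd : P ≤ d) (R : Matrix.orthogonalGroup (Fin d) ℝ) :
    Matrix (Fin P) (Fin d) ℝ :=
  (R : Matrix (Fin d) (Fin d) ℝ).submatrix (Fin.castLE hPd) id

theorem firstRows_mul_transpose {P d : ℕ} (hPd : P ≤ d)
    (R : Matrix.orthogonalGroup (Fin d) ℝ) :
    firstRows hPd R * (firstRows hPd R).transpose = 1 := by
  have h := (Matrix.mem_orthogonalGroup_iff (Fin d) ℝ).mp R.2
  ext i j
  have hij := congrFun (congrFun h (Fin.castLE hPd i)) (Fin.castLE hPd j)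
  simpa [firstRows, Matrix.mul_apply, Matrix.one_apply, Fin.ext_iff] using hij

theorem measurable_firstRows {P d : ℕ} (hPd : P ≤ d) :
    Measurable (firstRows hPd : Matrix.orthogonalGroup (Fin d) ℝ → _) := by
  refine Continuous.measurable ?_
  unfold firstRows
  fun_prop

/-- The law of a uniformly random semi-orthogonal matrix `M ∈ ℝ^{P × d}`, `M Mᵀ = I_P`: the first
`P` rows of a Haar-distributed orthogonal matrix. -/
noncomputable def uniformSemiorthogonal {P d : ℕ} (hPd : P ≤ d) :
    Measure (Matrix (Fin P) (Fin d) ℝ) :=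
  (haarOrthogonal d).map (firstRows hPd)

instance uniformSemiorthogonal_isProbabilityMeasure {P d : ℕ} (hPd : P ≤ d) :
    IsProbabilityMeasure (uniformSemiorthogonal hPd) :=
  Measure.isProbabilityMeasure_map (measurable_firstRows hPd).aemeasurable

/-! ### Correlational statistical query algorithms -/

/-- An adaptive CSQ algorithm making `n` queries on `ℝ^d`. The query number `t`, a function
`ℝ^d → [-1, 1]`, may depend on the responses to the queries `0, …, t - 1`, and the output, a
function `ℝ^d → ℝ`, on all `n` responses. -/
structure CSQAlgorithm (d n : ℕ) where
  query : (t : Fin n) → (Fin t → ℝ) → (Fin d → ℝ) → ℝ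
  query_measurable : ∀ t v, Measurable (query t v)
  query_bounded : ∀ t v x, query t v x ∈ Set.Icc (-1 : ℝ) 1
  output : (Fin n → ℝ) → (Fin d → ℝ) → ℝ
  output_measurable : ∀ v, Measurable (output v)

/-- `v` is a possible sequence of responses when the algorithm is run on the target `f` with
tolerance `τ`: every response is within `τ` of `E_x[φ(x) f(x)]`, `φ` being the query asked. -/
def CSQAlgorithm.IsTranscript {d n : ℕ} (A : CSQAlgorithm d n) (τ : ℝ) (f : (Fin d → ℝ) → ℝ)
    (v : Fin n → ℝ) : Prop :=
  ∀ t : Fin n,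
    |v t - ∫ x, A.query t (fun s => v (Fin.castLE t.isLt.le s)) x * f x ∂(stdGauss d)| ≤ τ

/-- The squared error `E_x[(f(x) - g(x))²] ∈ [0, ∞]` under `N(0, I_d)`. -/
noncomputable def sqError {d : ℕ} (f g : (Fin d → ℝ) → ℝ) : ENNReal :=
  ∫⁻ x, ENNReal.ofReal ((f x - g x) ^ 2) ∂(stdGauss d)

/-- The target function `f_{*,M}(x) = h(M x)`. -/
noncomputable def multiIndexTarget {P d : ℕ} (h : MvPolynomial (Fin P) ℝ)
    (M : Matrix (Fin P) (Fin d) ℝ) (x : Fin d → ℝ) : ℝ :=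
  MvPolynomial.eval (M.mulVec x) h

/-- The algorithm learns `f` to error below `c` from queries of tolerance `τ`: its output has error
below `c` whatever responses within the tolerance it is given. -/
def CSQAlgorithm.LearnsBelow {d n : ℕ} (A : CSQAlgorithm d n) (τ : ℝ) (f : (Fin d → ℝ) → ℝ)
    (c : ℝ) : Prop :=
  ∀ v : Fin n → ℝ, A.IsTranscript τ f v → sqError f (A.output v) < ENNReal.ofReal c

/-! ### The Hermite map -/

section HermiteMap

open MvPolynomial

/-! Second claim. Let H be `hermiteMap`. It commutes with derivatives and turns multiplication by
X_i into the Gaussian adjoint of ∂_i, so it treats any orthonormal family of linear forms as it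
treats the coordinates. For φ in L², p(v) = E[φ · H((v·X)^k)] is a homogeneous polynomial of degree
k with ‖H p‖ ≤ k! ‖φ‖ (`exists_isHomogeneous_eval_eq_hermitePairing`). The Haar average of p(Rᵀv)²
depends only on |v|, so it can be compared with a Gaussian v: for |v| = 1 it is at most d^(-k) E
p(g)² (`pow_mul_haarAvg_le`). The energy inequality E p(g)² ≤ B d^⌊k/2⌋ ‖H p‖²
(`exists_gaussExp_mul_self_le`) leaves d^(-⌈k/2⌉). Polarization passes from powers of one linear
form to products of several rows.

First claim. Choose axes Q attaining the isotropic leap ℓ. A maximal sequence of multi-indices with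
all increments below ℓ covers a set J of coordinates, and every remaining multi-index has degree at
least ℓ outside J (`exists_coords_of_leapOf`). So h = f₁ + f₂ in these axes, where f₁ sees only the
coordinates in J and f₂ ≠ 0 has only terms of degree at least ℓ outside J.

The adversary answers each query by rounding its correlation with f₁ to the grid τℤ. These answers
depend only on the rows in J, so O(d) splits into countably many cells, each determined by those
rows, and on each cell the queries and the output are fixed functions. Rotating the remaining rows
preserves a cell, and averaging over these rotations as in the second claim bounds the mean squared
correlation of a fixed function with f₂ by a multiple of d^(-ℓ/2)
(`exists_setLIntegral_sq_integral_hermiteSum_le`). By Markov and a union bound, outside a small part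
of the cell all queries correlate with f₂ by at most τ/2, which makes the rounded answers
admissible, and the output hardly correlates with f₂, which forces error at least ‖f₂‖²/2. Summing
over the disjoint cells costs nothing, however many transcripts there are. -/

theorem derivative_hermite_succ (n : ℕ) :
    Polynomial.derivative (Polynomial.hermite (n + 1)) =
      ((n : Polynomial ℤ) + 1) * Polynomial.hermite n := by
  induction n with
  | zero => simp
  | succ n ih =>
    have h1 := Polynomial.hermite_succ (n + 1)
    have h2 := Polynomial.hermite_succ n
    rw [h1, ih]
    have h3 : Polynomial.derivative (((n : Polynomial ℤ) + 1) * Polynomial.hermite n) =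
        ((n : Polynomial ℤ) + 1) * Polynomial.derivative (Polynomial.hermite n) := by
      rw [Polynomial.derivative_mul]
      simp
    rw [Polynomial.derivative_sub, Polynomial.derivative_mul, h3, ih, Polynomial.derivative_X]
    push_cast
    linear_combination (-(n : Polynomial ℤ) - 1) * h2

theorem derivative_hermite (n : ℕ) :
    Polynomial.derivative (Polynomial.hermite n) =
      (n : Polynomial ℤ) * Polynomial.hermite (n - 1) := by
  cases n with
  | zero => simp
  | succ n => rw [derivative_hermite_succ]; simp

theorem hermite_succ_eq (n : ℕ) :
    Polynomial.hermite (n + 1) = Polynomial.X * Polynomial.hermite n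
      - (n : Polynomial ℤ) * Polynomial.hermite (n - 1) := by
  rw [Polynomial.hermite_succ, derivative_hermite]

theorem eval_polynomial_aeval {σ : Type*} (x : σ → ℝ) (q : MvPolynomial σ ℝ) (p : Polynomial ℤ) :
    eval x (Polynomial.aeval q p) = Polynomial.aeval (eval x q) p := by
  have h := Polynomial.aeval_algHom_apply
    ((MvPolynomial.aeval (R := ℝ) x).restrictScalars ℤ) q p
  have he : ∀ q : MvPolynomial σ ℝ, MvPolynomial.aeval (R := ℝ) x q = eval x q :=
    fun q => by rw [MvPolynomial.aeval_eq_eval]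
  simp only [AlgHom.restrictScalars_apply, he] at h
  exact h.symm

variable {ι : Type*} [Fintype ι]

/-- The multivariate Hermite polynomial `∏ i, He_{β i}(X i)`. -/
noncomputable def hermiteMv (β : ι → ℕ) : MvPolynomial ι ℝ :=
  ∏ i, Polynomial.aeval (X i) (Polynomial.hermite (β i))

/-- The linear map sending the monomial `X^β` to `∏ i, He_{β i}(X i)`. -/
noncomputable def hermiteMap : MvPolynomial ι ℝ →ₗ[ℝ] MvPolynomial ι ℝ :=
  (basisMonomials ι ℝ).constr ℝ fun β => hermiteMv β

theorem hermiteMap_monomial (β : ι →₀ ℕ) (a : ℝ) :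
    hermiteMap (monomial β a) = a • hermiteMv (β : ι → ℕ) := by
  have : monomial β a = a • basisMonomials ι ℝ β := by
    rw [coe_basisMonomials, smul_monomial]; simp
  rw [this, map_smul, hermiteMap, Module.Basis.constr_basis]

theorem hermiteMap_one : hermiteMap (1 : MvPolynomial ι ℝ) = 1 := by
  have := hermiteMap_monomial (0 : ι →₀ ℕ) 1
  simpa [hermiteMv] using this

theorem pderiv_aeval_X {ι : Type*} (i j : ι) [DecidableEq ι] (p : Polynomial ℤ) :
    pderiv i (Polynomial.aeval (X j : MvPolynomial ι ℝ) p) =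
      if i = j then Polynomial.aeval (X j) (Polynomial.derivative p) else 0 := by
  have h := (Derivation.restrictScalars ℤ (pderiv (R := ℝ) i)).map_aeval p (X j)
  simp only [Derivation.restrictScalars_apply] at h
  rw [h, pderiv_X]
  split_ifs with hij
  · subst hij; simp
  · simp [Ne.symm hij]

/-- Isolates the factor in X_i: the cofactor `r` is constant for ∂_i, so derivative and recurrence
formulas reduce to one variable. -/
theorem exists_hermiteMv_update_eq [DecidableEq ι] (i : ι) (β : ι → ℕ) :
    ∃ r : MvPolynomial ι ℝ, pderiv i r = 0 ∧ ∀ n, hermiteMv (Function.update β i n) =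
      Polynomial.aeval (X i) (Polynomial.hermite n) * r := by
  refine ⟨∏ x ∈ Finset.univ.erase i, Polynomial.aeval (X x) (Polynomial.hermite (β x)), ?_, ?_⟩
  · apply Finset.prod_induction _ (fun p => pderiv i p = 0)
    · intro a b ha hb; rw [Derivation.leibniz, ha, hb]; simp
    · exact pderiv_one
    · intro x hx
      rw [pderiv_aeval_X, if_neg (Finset.ne_of_mem_erase hx).symm]
  · intro n
    rw [hermiteMv, ← Finset.mul_prod_erase _ _ (Finset.mem_univ i), Function.update_self]
    congr 1
    exact Finset.prod_congr rfl fun x hx => by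
      rw [Function.update_of_ne (Finset.ne_of_mem_erase hx)]

theorem pderiv_hermiteMv [DecidableEq ι] (i : ι) (β : ι → ℕ) :
    pderiv i (hermiteMv β) = (β i : ℝ) • hermiteMv (β - Pi.single i 1) := by
  obtain ⟨r, hr, h⟩ := exists_hermiteMv_update_eq i β
  have h1 : β - Pi.single i 1 = Function.update β i (β i - 1) := by
    ext j; by_cases hj : j = i
    · subst hj; simp
    · simp [hj]
  have h2 := h (β i)
  rw [Function.update_eq_self] at h2
  rw [h1, h, h2, Derivation.leibniz, hr, pderiv_aeval_X, if_pos rfl, derivative_hermite]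
  simp only [map_mul, map_natCast, smul_eq_mul, smul_eq_C_mul]
  ring

theorem hermiteMv_add_single [DecidableEq ι] (i : ι) (β : ι → ℕ) :
    hermiteMv (β + Pi.single i 1) =
      X i * hermiteMv β - (β i : ℝ) • hermiteMv (β - Pi.single i 1) := by
  rw [← pderiv_hermiteMv]
  obtain ⟨r, hr, h⟩ := exists_hermiteMv_update_eq i β
  have h1 : β + Pi.single i 1 = Function.update β i (β i + 1) := by
    ext j; by_cases hj : j = i
    · subst hj; simp
    · simp [hj]
  have h2 := h (β i)
  rw [Function.update_eq_self] at h2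
  rw [h1, h, h2, Derivation.leibniz, hr, pderiv_aeval_X, if_pos rfl, Polynomial.hermite_succ]
  simp only [map_sub, map_mul, Polynomial.aeval_X, smul_eq_mul, mul_zero, zero_add]
  ring

theorem pderiv_hermiteMap (i : ι) (q : MvPolynomial ι ℝ) :
    pderiv i (hermiteMap q) = hermiteMap (pderiv i q) := by
  classical
  induction q using MvPolynomial.induction_on' with
  | monomial β a =>
    rw [hermiteMap_monomial, Derivation.map_smul, pderiv_hermiteMv, pderiv_monomial,
      hermiteMap_monomial, smul_smul]
    congr 2
  | add p q hp hq => simp [hp, hq]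

/-- The three-term recurrence without indices. Being linear in the direction, it extends from
coordinates to all linear forms, which is how rotations are handled. -/
theorem hermiteMap_X_mul (i : ι) (q : MvPolynomial ι ℝ) :
    hermiteMap (X i * q) = X i * hermiteMap q - hermiteMap (pderiv i q) := by
  classical
  induction q using MvPolynomial.induction_on' with
  | monomial β a =>
    rw [← pderiv_hermiteMap, X, monomial_mul, hermiteMap_monomial, hermiteMap_monomial,
      Derivation.map_smul, pderiv_hermiteMv]
    have : ((Finsupp.single i 1 + β : ι →₀ ℕ) : ι → ℕ) = (β : ι → ℕ) + Pi.single i 1 := by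
      ext j; simp [Finsupp.single_apply, Pi.single_apply, eq_comm, add_comm]
    rw [this, hermiteMv_add_single, one_mul, smul_sub, mul_smul_comm, X]
  | add p q hp hq => simp only [mul_add, map_add, hp, hq]; ring

theorem hermiteMap_surjective : Function.Surjective (hermiteMap (ι := ι)) := by
  intro p
  induction p using MvPolynomial.induction_on with
  | C a => exact ⟨C a, by rw [← mul_one (C a), ← smul_eq_C_mul, map_smul, hermiteMap_one]⟩
  | add p q hp hq =>
    obtain ⟨a, rfl⟩ := hp
    obtain ⟨b, rfl⟩ := hq
    exact ⟨a + b, map_add _ _ _⟩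
  | mul_X p i hp =>
    obtain ⟨a, rfl⟩ := hp
    -- The recurrence solved for `X i * hermiteMap a`.
    refine ⟨X i * a + pderiv i a, ?_⟩
    rw [map_add, hermiteMap_X_mul]; ring

/-- The linear form `∑ i, v i • X i`. -/
noncomputable def linForm (v : ι → ℝ) : MvPolynomial ι ℝ := ∑ i, C (v i) * X i

/-- The directional derivative `∑ i, v i • ∂ᵢ`. -/
noncomputable def dirDeriv (v : ι → ℝ) :
    Derivation ℝ (MvPolynomial ι ℝ) (MvPolynomial ι ℝ) := ∑ i, v i • pderiv i

theorem dirDeriv_apply (v : ι → ℝ) (q : MvPolynomial ι ℝ) :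
    dirDeriv v q = ∑ i, v i • pderiv i q := by
  have := congrFun (map_sum (Derivation.coeFnAddMonoidHom (R := ℝ) (A := MvPolynomial ι ℝ)
    (M := MvPolynomial ι ℝ)) (fun i => v i • pderiv i) Finset.univ) q
  rw [Finset.sum_apply] at this
  exact this

theorem dirDeriv_linForm (v w : ι → ℝ) : dirDeriv v (linForm w) = C (v ⬝ᵥ w) := by
  classical
  rw [dirDeriv_apply]
  simp only [linForm, map_sum, pderiv_C_mul, pderiv_X, dotProduct, map_mul]
  refine Finset.sum_congr rfl fun i _ => ?_
  simp [Pi.single_apply, smul_eq_C_mul]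

theorem hermiteMap_linForm_mul (v : ι → ℝ) (q : MvPolynomial ι ℝ) :
    hermiteMap (linForm v * q) = linForm v * hermiteMap q - hermiteMap (dirDeriv v q) := by
  rw [dirDeriv_apply, linForm, Finset.sum_mul, Finset.sum_mul, map_sum, map_sum,
    ← Finset.sum_sub_distrib]
  refine Finset.sum_congr rfl fun i _ => ?_
  rw [mul_assoc, ← smul_eq_C_mul, map_smul, hermiteMap_X_mul, map_smul, smul_sub, mul_assoc,
    ← smul_eq_C_mul]

theorem eval_linForm (v x : ι → ℝ) : eval x (linForm v) = v ⬝ᵥ x := by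
  simp [linForm, dotProduct]

/-- Rotation invariance of the Hermite map. The derivative along `v i` kills every other form of the
orthonormal family, so the recurrence along `v i` is the one-variable Hermite recurrence; it lowers
the exponent by one and by two, hence the strong induction on the total degree. -/
theorem hermiteMap_prod_linForm_pow {κ : Type*} [Fintype κ] [DecidableEq κ] (v : κ → ι → ℝ)
    (hv : ∀ i j, v i ⬝ᵥ v j = if i = j then 1 else 0) (α : κ → ℕ) :
    hermiteMap (∏ j, linForm (v j) ^ α j) =
      ∏ j, Polynomial.aeval (linForm (v j)) (Polynomial.hermite (α j)) := by
  generalize hn : ∑ j, α j = n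
  induction n using Nat.strong_induction_on generalizing α with
  | _ n ih =>
  by_cases hα : ∀ j, α j = 0
  · simp [hα, hermiteMap_one]
  push Not at hα
  obtain ⟨i, hi⟩ := hα
  set m := α i - 1 with hm
  have him : α i = m + 1 := by omega
  set rest := ∏ j ∈ Finset.univ.erase i, linForm (v j) ^ α j with hrest
  have hD : dirDeriv (v i) rest = 0 := by
    apply Finset.prod_induction _ (fun p => dirDeriv (v i) p = 0)
    · intro a b ha hb; rw [Derivation.leibniz, ha, hb]; simp
    · exact Derivation.map_one_eq_zero _
    · intro x hx
      rw [Derivation.leibniz_pow, dirDeriv_linForm, hv, if_neg (Finset.ne_of_mem_erase hx).symm]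
      simp
  have split : ∀ β : κ → ℕ, (∀ j ≠ i, β j = α j) →
      ∏ j, linForm (v j) ^ β j = linForm (v i) ^ β i * rest := by
    intro β hβ
    rw [← Finset.mul_prod_erase _ _ (Finset.mem_univ i), hrest]
    congr 1
    exact Finset.prod_congr rfl fun x hx => by rw [hβ x (Finset.ne_of_mem_erase hx)]
  have split' : ∀ β : κ → ℕ, (∀ j ≠ i, β j = α j) →
      ∏ j, Polynomial.aeval (linForm (v j)) (Polynomial.hermite (β j)) =
        Polynomial.aeval (linForm (v i)) (Polynomial.hermite (β i)) *
        ∏ j ∈ Finset.univ.erase i, Polynomial.aeval (linForm (v j))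
          (Polynomial.hermite (α j)) := by
    intro β hβ
    rw [← Finset.mul_prod_erase _ _ (Finset.mem_univ i)]
    congr 1
    exact Finset.prod_congr rfl fun x hx => by rw [hβ x (Finset.ne_of_mem_erase hx)]
  have hsum : ∀ c, ∑ j, Function.update α i c j = c + (n - α i) := by
    intro c
    rw [Finset.sum_update_of_mem (Finset.mem_univ i), ← hn,
      ← Finset.add_sum_erase _ _ (Finset.mem_univ i), ← Finset.erase_eq]
    omega
  have hle : α i ≤ n := hn ▸ Finset.single_le_sum (fun _ _ => Nat.zero_le _) (Finset.mem_univ i)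
  have key : ∀ c < α i, hermiteMap (linForm (v i) ^ c * rest) =
      Polynomial.aeval (linForm (v i)) (Polynomial.hermite c) *
        ∏ j ∈ Finset.univ.erase i, Polynomial.aeval (linForm (v j))
          (Polynomial.hermite (α j)) := by
    intro c hc
    have hup : ∀ j ≠ i, Function.update α i c j = α j := fun j hj =>
      Function.update_of_ne hj _ _
    have := ih _ (by rw [← hn]; omega) (Function.update α i c) (hsum c)
    rw [split _ hup, split' _ hup, Function.update_self] at this
    exact this
  rw [split α (fun _ _ => rfl), split' α (fun _ _ => rfl), him, pow_succ', mul_assoc,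
    hermiteMap_linForm_mul, Derivation.leibniz, hD, Derivation.leibniz_pow, dirDeriv_linForm, hv,
    if_pos rfl, key m (by omega), hermite_succ_eq]
  have hmv : linForm (v i) ^ m • (0 : MvPolynomial ι ℝ) +
      rest • m • linForm (v i) ^ (m - 1) • C 1 = m • (linForm (v i) ^ (m - 1) * rest) := by
    simp only [map_one, smul_eq_mul, mul_one, mul_zero, zero_add, nsmul_eq_mul]
    ring
  rw [hmv, map_nsmul]
  simp only [map_sub, map_mul, Polynomial.aeval_X, map_natCast]
  -- For `m = 0` the truncated exponent `m - 1` is harmless: its term carries the factor `m`.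
  rcases Nat.eq_zero_or_pos m with h0 | h0
  · rw [h0]; simp
  · rw [key (m - 1) (by omega), nsmul_eq_mul]; ring

/-- Polarization: a product of `k` elements as a combination of `k`-th powers of their signed
sums. -/
theorem sum_sign_mul_sum_pow {A : Type*} [CommRing A] (k : ℕ) (y : Fin k → A) :
    ∑ ε : Fin k → ℤˣ, (∏ i, ((ε i : ℤ) : A)) * (∑ i, ((ε i : ℤ) : A) * y i) ^ k =
      (2 ^ k * k.factorial : ℕ) * ∏ i, y i := by
  classical
  have h1 : ∀ ε : Fin k → ℤˣ, (∏ i, ((ε i : ℤ) : A)) * (∑ i, ((ε i : ℤ) : A) * y i) ^ k =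
      ∑ f : Fin k → Fin k, (∏ i, ((ε i : ℤ) : A) * ∏ j, if f j = i then ((ε i : ℤ) : A) else 1) *
        ∏ j, y (f j) := by
    intro ε
    have : (∑ i, ((ε i : ℤ) : A) * y i) ^ k = ∏ _j : Fin k, ∑ i, ((ε i : ℤ) : A) * y i := by simp
    rw [this, Finset.prod_univ_sum, Fintype.piFinset_univ, Finset.mul_sum]
    refine Finset.sum_congr rfl fun f _ => ?_
    rw [Finset.prod_mul_distrib, Finset.prod_mul_distrib, Finset.prod_comm (s := Finset.univ)
      (t := Finset.univ) (f := fun i j => if f j = i then ((ε i : ℤ) : A) else 1)]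
    simp [mul_assoc]
  simp_rw [h1]
  rw [Finset.sum_comm]
  -- The sign sum factors over i. If `f` misses i, that factor is the sum of the two signs, which is
  -- 0; if `f` is bijective, every factor is a sum of two squares of signs, which is 2.
  have h2 : ∀ f : Fin k → Fin k, ∑ ε : Fin k → ℤˣ,
      (∏ i, ((ε i : ℤ) : A) * ∏ j, if f j = i then ((ε i : ℤ) : A) else 1) * ∏ j, y (f j) =
      if Function.Bijective f then (2 ^ k : A) * ∏ j, y j else 0 := by
    intro f
    rw [← Finset.sum_mul]
    have h3 := Finset.prod_univ_sum (fun _ : Fin k => (Finset.univ : Finset ℤˣ))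
      (fun i e => ((e : ℤ) : A) * ∏ j, if f j = i then ((e : ℤ) : A) else 1)
    rw [Fintype.piFinset_univ] at h3
    rw [← h3]
    split_ifs with hf
    · have h4 : ∀ i, ∑ e : ℤˣ, (((e : ℤ) : A) * ∏ j, if f j = i then ((e : ℤ) : A) else 1) =
          2 := by
        intro i
        obtain ⟨j₀, hj₀⟩ := hf.2 i
        have h5 : ∀ e : ℤˣ, (∏ j, if f j = i then ((e : ℤ) : A) else 1) = ((e : ℤ) : A) := by
          intro e
          rw [Finset.prod_eq_single j₀]
          · simp [hj₀]
          · intro b _ hb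
            rw [if_neg fun h => hb (hf.1 (h.trans hj₀.symm))]
          · simp
        simp_rw [h5]
        rw [show (Finset.univ : Finset ℤˣ) = {1, -1} from rfl, Finset.sum_pair (by decide)]
        norm_num
      simp_rw [h4]
      rw [Finset.prod_const, Finset.card_univ, Fintype.card_fin,
        Function.Bijective.prod_comp hf y]
    · have hns : ¬ Function.Surjective f := fun h => hf (Finite.surjective_iff_bijective.mp h)
      rw [Function.Surjective] at hns
      push Not at hns
      obtain ⟨i, hi⟩ := hns
      rw [Finset.prod_eq_zero (Finset.mem_univ i), zero_mul]
      rw [show (Finset.univ : Finset ℤˣ) = {1, -1} from rfl, Finset.sum_pair (by decide)]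
      simp [hi]
  simp_rw [h2]
  rw [← Finset.sum_filter, Finset.sum_const, nsmul_eq_mul]
  have h6 : (Finset.univ.filter fun f : Fin k → Fin k => Function.Bijective f).card =
      k.factorial := by
    rw [← Fintype.card_subtype, Fintype.card_congr (Equiv.ofBijective
      (fun e : Equiv.Perm (Fin k) => (⟨e, e.bijective⟩ : {f : Fin k → Fin k //
        Function.Bijective f})) ⟨fun a b h => ?_, fun f => ⟨Equiv.ofBijective f.1 f.2, ?_⟩⟩).symm,
      Fintype.card_perm, Fintype.card_fin]
    · ext x; simpa using congrArg (fun g => ((g.1 x : Fin k) : ℕ)) h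
    · ext x; simp
  rw [h6]
  push_cast
  ring

end HermiteMap

/-! ### Polynomials under the Gaussian measure -/

section GaussianPolynomials

open MvPolynomial

theorem integrable_pow_gaussianReal (n : ℕ) :
    Integrable (fun x : ℝ => x ^ n) (gaussianReal 0 1) := by
  have h := (memLp_id_gaussianReal' (μ := 0) (v := 1) (n : ENNReal) (by simp)).integrable_norm_pow'
  refine (integrable_norm_iff (by fun_prop)).1 ?_
  simpa using h

theorem hasDerivAt_gaussianPDFReal (x : ℝ) :
    HasDerivAt (gaussianPDFReal 0 1) (-x * gaussianPDFReal 0 1 x) x := by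
  have h : gaussianPDFReal 0 1 =
      fun x : ℝ => (√(2 * Real.pi * (1 : NNReal)))⁻¹ * Real.exp (-(x - 0) ^ 2 / (2 * (1 : NNReal))) := by
    ext x; rfl
  rw [h]
  have h2 : HasDerivAt (fun x : ℝ => -(x - 0) ^ 2 / (2 * (1 : NNReal))) (-x) x := by
    have h3 : (fun x : ℝ => -(x - 0) ^ 2 / (2 * ((1 : NNReal) : ℝ))) =
        fun x : ℝ => -(x ^ 2) / 2 := by
      ext y; simp
    rw [h3]
    exact ((hasDerivAt_pow 2 x).neg.div_const 2).congr_deriv (by push_cast; ring)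
  exact (h2.exp.const_mul ((√(2 * Real.pi * (1 : NNReal)))⁻¹)).congr_deriv (by ring)

theorem integral_pow_succ_gaussianReal (n : ℕ) :
    ∫ x, x ^ (n + 1) ∂(gaussianReal 0 1) = n * ∫ x, x ^ (n - 1) ∂(gaussianReal 0 1) := by
  have hint : ∀ m : ℕ, Integrable fun x : ℝ => gaussianPDFReal 0 1 x * x ^ m := by
    intro m
    have h := integrable_pow_gaussianReal m
    rw [gaussianReal_of_var_ne_zero _ one_ne_zero,
      integrable_withDensity_iff_integrable_smul₀' (by fun_prop)
        (ae_of_all _ fun _ => gaussianPDF_lt_top)] at h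
    simpa [toReal_gaussianPDF] using h
  have hd : ∀ x : ℝ, HasDerivAt (fun x : ℝ => gaussianPDFReal 0 1 x * x ^ n)
      (n * (gaussianPDFReal 0 1 x * x ^ (n - 1)) - gaussianPDFReal 0 1 x * x ^ (n + 1)) x := by
    intro x
    exact ((hasDerivAt_gaussianPDFReal x).mul (hasDerivAt_pow n x)).congr_deriv (by ring)
  have h0 := integral_eq_zero_of_hasDerivAt_of_integrable hd
    (((hint (n - 1)).const_mul _).sub (hint (n + 1))) (hint n)
  rw [integral_sub ((hint (n - 1)).const_mul _) (hint (n + 1)), integral_const_mul] at h0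
  rw [integral_gaussianReal_eq_integral_smul one_ne_zero,
    integral_gaussianReal_eq_integral_smul one_ne_zero]
  simp only [smul_eq_mul]
  linarith

variable {ι : Type*} [Fintype ι]

variable (ι) in
/-- The standard Gaussian measure on `ι → ℝ`. -/
noncomputable def gauss : Measure (ι → ℝ) := Measure.pi fun _ => gaussianReal 0 1

instance : IsProbabilityMeasure (gauss ι) := by unfold gauss; infer_instance

theorem eval_monomial_eq_prod (x : ι → ℝ) (β : ι →₀ ℕ) (a : ℝ) :
    eval x (monomial β a) = a * ∏ i, x i ^ β i := by
  rw [eval_monomial, Finsupp.prod_fintype _ _ (by simp)]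

theorem integrable_eval_gauss (q : MvPolynomial ι ℝ) :
    Integrable (fun x : ι → ℝ => eval x q) (gauss ι) := by
  induction q using MvPolynomial.induction_on' with
  | monomial β a =>
    simp_rw [eval_monomial_eq_prod]
    exact (Integrable.fintype_prod (f := fun i x => x ^ β i)
      fun i => integrable_pow_gaussianReal _).const_mul a
  | add p q hp hq => simp only [map_add]; exact hp.add hq

variable (ι) in
/-- The Gaussian expectation of a polynomial. -/
noncomputable def gaussExp : MvPolynomial ι ℝ →ₗ[ℝ] ℝ where
  toFun q := ∫ x, eval x q ∂(gauss ι)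
  map_add' p q := by
    simp only [map_add]
    exact integral_add (integrable_eval_gauss p) (integrable_eval_gauss q)
  map_smul' a q := by simp only [smul_eval]; exact integral_const_mul _ _

theorem gaussExp_apply (q : MvPolynomial ι ℝ) : gaussExp ι q = ∫ x, eval x q ∂(gauss ι) := rfl

theorem gaussExp_one : gaussExp ι 1 = 1 := by simp [gaussExp_apply]

theorem gaussExp_mul_self_nonneg (q : MvPolynomial ι ℝ) : 0 ≤ gaussExp ι (q * q) := by
  rw [gaussExp_apply]
  exact integral_nonneg fun x => by simp only [map_mul]; exact mul_self_nonneg _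

theorem gaussExp_monomial (β : ι →₀ ℕ) (a : ℝ) :
    gaussExp ι (monomial β a) = a * ∏ i, ∫ x, x ^ β i ∂(gaussianReal 0 1) := by
  rw [gaussExp_apply]
  simp_rw [eval_monomial_eq_prod]
  rw [integral_const_mul, gauss, integral_fintype_prod_eq_prod (fun i x => x ^ β i)]

/-- Gaussian integration by parts. -/
theorem gaussExp_X_mul (i : ι) (q : MvPolynomial ι ℝ) :
    gaussExp ι (X i * q) = gaussExp ι (pderiv i q) := by
  classical
  induction q using MvPolynomial.induction_on' with
  | monomial β a =>
    rw [X, monomial_mul, one_mul, pderiv_monomial, gaussExp_monomial, gaussExp_monomial,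
      ← Finset.mul_prod_erase Finset.univ
        (fun j => ∫ x, x ^ (Finsupp.single i 1 + β : ι →₀ ℕ) j ∂(gaussianReal 0 1))
        (Finset.mem_univ i),
      ← Finset.mul_prod_erase Finset.univ
        (fun j => ∫ x, x ^ (β - Finsupp.single i 1 : ι →₀ ℕ) j ∂(gaussianReal 0 1))
        (Finset.mem_univ i)]
    have h1 : ∏ j ∈ Finset.univ.erase i, ∫ x, x ^ (Finsupp.single i 1 + β : ι →₀ ℕ) j ∂(gaussianReal 0 1) =
        ∏ j ∈ Finset.univ.erase i, ∫ x, x ^ β j ∂(gaussianReal 0 1) :=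
      Finset.prod_congr rfl fun j hj => by simp [Finset.ne_of_mem_erase hj]
    have h2 : ∏ j ∈ Finset.univ.erase i, ∫ x, x ^ (β - Finsupp.single i 1 : ι →₀ ℕ) j ∂(gaussianReal 0 1) =
        ∏ j ∈ Finset.univ.erase i, ∫ x, x ^ β j ∂(gaussianReal 0 1) :=
      Finset.prod_congr rfl fun j hj => by simp [Finset.ne_of_mem_erase hj]
    rw [h1, h2]
    have h3 : (Finsupp.single i 1 + β : ι →₀ ℕ) i = β i + 1 := by simp [add_comm]
    have h4 : (β - Finsupp.single i 1 : ι →₀ ℕ) i = β i - 1 := by simp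
    rw [h3, h4, integral_pow_succ_gaussianReal]
    ring
  | add p q hp hq => simp only [mul_add, map_add, hp, hq]

/-- Adjointness: integration by parts also produces a derivative of `hermiteMap p`, which the
correction term of the recurrence cancels. -/
theorem gaussExp_hermiteMap_X_mul (i : ι) (p q : MvPolynomial ι ℝ) :
    gaussExp ι (hermiteMap (X i * p) * q) = gaussExp ι (hermiteMap p * pderiv i q) := by
  have h : hermiteMap (X i * p) * q = X i * (hermiteMap p * q) - pderiv i (hermiteMap p) * q := by
    rw [hermiteMap_X_mul, pderiv_hermiteMap]; ring
  rw [h, map_sub, gaussExp_X_mul, Derivation.leibniz, ← map_sub]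
  congr 1
  simp only [smul_eq_mul]; ring

theorem gaussExp_hermiteMv_mul_hermiteMv (β γ : ι →₀ ℕ) :
    gaussExp ι (hermiteMv β * hermiteMv γ) =
      if β = γ then ∏ i, ((β i).factorial : ℝ) else 0 := by
  classical
  -- Induction on the degree of β: one X_i is stripped from β and moved by adjointness to γ as a
  -- derivative.
  have key : ∀ n : ℕ, ∀ β γ : ι →₀ ℕ, β.degree = n →
      gaussExp ι (hermiteMap (monomial β 1) * hermiteMap (monomial γ 1)) =
      if β = γ then ∏ i, ((β i).factorial : ℝ) else 0 := by
    intro n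
    induction n with
    | zero =>
      intro β γ hβ
      obtain rfl : β = 0 := (Finsupp.degree_eq_zero_iff β).1 hβ
      have h1 : hermiteMap (monomial (0 : ι →₀ ℕ) (1 : ℝ)) = 1 := hermiteMap_one
      rw [h1, one_mul]
      by_cases hγ : γ = 0
      · subst hγ; rw [h1, gaussExp_one]; simp
      · rw [if_neg (Ne.symm hγ)]
        obtain ⟨i, hi⟩ := Finsupp.ne_iff.1 hγ
        have hle : Finsupp.single i 1 ≤ γ := by
          rw [Finsupp.single_le_iff]; exact Nat.one_le_iff_ne_zero.2 hi
        obtain ⟨γ', rfl⟩ := exists_add_of_le hle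
        have := gaussExp_hermiteMap_X_mul i (monomial γ' 1) (1 : MvPolynomial ι ℝ)
        rw [X, monomial_mul, mul_one, mul_one] at this
        rw [this, pderiv_one]; simp
    | succ n ih =>
      intro β γ hβ
      have hβ0 : β ≠ 0 := by rintro rfl; simp at hβ
      obtain ⟨i, hi⟩ := Finsupp.ne_iff.1 hβ0
      have hle : Finsupp.single i 1 ≤ β := by
        rw [Finsupp.single_le_iff]; exact Nat.one_le_iff_ne_zero.2 hi
      obtain ⟨β', rfl⟩ := exists_add_of_le hle
      have hβ' : β'.degree = n := by
        rw [map_add, Finsupp.degree_single] at hβ; omega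
      have h := gaussExp_hermiteMap_X_mul i (monomial β' 1) (hermiteMap (monomial γ 1))
      rw [X, monomial_mul, mul_one, pderiv_hermiteMap, pderiv_monomial, one_mul] at h
      have h2 : monomial (γ - Finsupp.single i 1) (γ i : ℝ) =
          (γ i : ℝ) • monomial (γ - Finsupp.single i 1) 1 := by rw [smul_monomial]; simp
      rw [h, h2, map_smul, mul_smul_comm, map_smul, ih _ _ hβ', smul_eq_mul]
      by_cases hγ : γ i = 0
      · have hne : ¬ (Finsupp.single i 1 + β' = γ) := by rintro rfl; simp at hγ
        rw [hγ, if_neg hne, Nat.cast_zero, zero_mul]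
      · have hle' : Finsupp.single i 1 ≤ γ := by
          rw [Finsupp.single_le_iff]; exact Nat.one_le_iff_ne_zero.2 hγ
        obtain ⟨γ', rfl⟩ := exists_add_of_le hle'
        rw [add_tsub_cancel_left]
        by_cases hb : β' = γ'
        · subst hb
          rw [if_pos rfl, if_pos rfl, ← Finset.mul_prod_erase Finset.univ
              (fun j => ((β' j).factorial : ℝ)) (Finset.mem_univ i),
            ← Finset.mul_prod_erase Finset.univ
              (fun j => (((Finsupp.single i 1 + β' : ι →₀ ℕ) j).factorial : ℝ))
              (Finset.mem_univ i)]
          have h1 : ∏ j ∈ Finset.univ.erase i, (((Finsupp.single i 1 + β' : ι →₀ ℕ) j).factorial : ℝ) =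
              ∏ j ∈ Finset.univ.erase i, ((β' j).factorial : ℝ) :=
            Finset.prod_congr rfl fun j hj => by simp [Finset.ne_of_mem_erase hj]
          have h3 : (Finsupp.single i 1 + β' : ι →₀ ℕ) i = β' i + 1 := by simp [add_comm]
          rw [h1, h3, Nat.factorial_succ]
          push_cast
          ring
        · rw [if_neg hb, if_neg (fun h => hb (add_left_cancel h)), mul_zero]
  have := key _ β γ rfl
  simp only [hermiteMap_monomial, one_smul] at this
  convert this

/-! ### The energy inequality -/

/-- The squared `L²` norm of the Hermite image of a polynomial. -/
noncomputable def fischerSq (q : MvPolynomial ι ℝ) : ℝ :=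
  gaussExp ι (hermiteMap q * hermiteMap q)

theorem fischerSq_nonneg (q : MvPolynomial ι ℝ) : 0 ≤ fischerSq q :=
  gaussExp_mul_self_nonneg _

/-- Adjointness moves one ∂_i back as multiplication by X_i, and Euler's identity sums X_i ∂_i q to
k q. -/
theorem sum_fischerSq_pderiv {q : MvPolynomial ι ℝ} {k : ℕ} (hq : q.IsHomogeneous k) :
    ∑ i, fischerSq (pderiv i q) = k * fischerSq q := by
  have h1 : ∀ i, fischerSq (pderiv i q) = gaussExp ι (hermiteMap (X i * pderiv i q) *
      hermiteMap q) := by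
    intro i
    rw [gaussExp_hermiteMap_X_mul, pderiv_hermiteMap, fischerSq]
  simp_rw [h1]
  rw [← map_sum, ← Finset.sum_mul, ← map_sum, hq.sum_X_mul_pderiv, map_nsmul, smul_mul_assoc,
    map_nsmul, fischerSq, nsmul_eq_mul]

theorem gaussExp_sum_sq_le (f : ι → MvPolynomial ι ℝ) :
    gaussExp ι ((∑ i, f i) * ∑ i, f i) ≤ Fintype.card ι * ∑ i, gaussExp ι (f i * f i) := by
  rw [← map_sum, ← smul_eq_mul (a := (Fintype.card ι : ℝ)), ← map_smul, gaussExp_apply,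
    gaussExp_apply]
  refine integral_mono (integrable_eval_gauss _) (integrable_eval_gauss _) fun x => ?_
  simp only [map_sum, smul_eval, ← pow_two]
  have := sq_sum_le_card_mul_sum_sq (s := Finset.univ) (f := fun i => eval x (f i))
  simpa using this

/-- The Laplacian is where the dimension enters: Cauchy–Schwarz over the diagonal costs
`Fintype.card ι`, while the sum over all second derivatives costs only k(k-1), by Euler twice. -/
theorem fischerSq_sum_pderiv_pderiv_le {q : MvPolynomial ι ℝ} {k : ℕ} (hq : q.IsHomogeneous k) :
    fischerSq (∑ i, pderiv i (pderiv i q)) ≤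
      Fintype.card ι * (k * (k - 1 : ℕ) * fischerSq q) := by
  rw [fischerSq, map_sum]
  refine (gaussExp_sum_sq_le _).trans ?_
  refine mul_le_mul_of_nonneg_left ?_ (Nat.cast_nonneg _)
  calc ∑ i, fischerSq (pderiv i (pderiv i q))
      ≤ ∑ i, ∑ j, fischerSq (pderiv j (pderiv i q)) :=
        Finset.sum_le_sum fun i _ => Finset.single_le_sum
          (f := fun j => fischerSq (pderiv j (pderiv i q)))
          (fun j _ => fischerSq_nonneg _) (Finset.mem_univ i)
    _ = ∑ i, ((k - 1 : ℕ) : ℝ) * fischerSq (pderiv i q) :=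
        Finset.sum_congr rfl fun i _ => sum_fischerSq_pderiv hq.pderiv
    _ = _ := by rw [← Finset.mul_sum, sum_fischerSq_pderiv hq]; ring

/-- Euler's identity and integration by parts give k E q² = ∑ E(∂_i q)² + E[q Δq]. The last term is
at most (E(Δq)² + E q²)/2, and k ≥ 1 absorbs the E q². -/
theorem gaussExp_mul_self_energy {q : MvPolynomial ι ℝ} {k : ℕ} (hq : q.IsHomogeneous k)
    (hk : 1 ≤ k) :
    gaussExp ι (q * q) ≤ 2 * ∑ i, gaussExp ι (pderiv i q * pderiv i q) +
      gaussExp ι ((∑ i, pderiv i (pderiv i q)) * ∑ i, pderiv i (pderiv i q)) := by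
  set L := ∑ i, pderiv i (pderiv i q) with hL
  have h1 : (k : ℝ) * gaussExp ι (q * q) =
      ∑ i, gaussExp ι (pderiv i q * pderiv i q) + gaussExp ι (L * q) := by
    have h2 : k • (q * q) = ∑ i, X i * (pderiv i q * q) := by
      rw [← smul_mul_assoc, ← hq.sum_X_mul_pderiv, Finset.sum_mul]
      exact Finset.sum_congr rfl fun i _ => by ring
    rw [← nsmul_eq_mul, ← map_nsmul, h2, map_sum, hL, Finset.sum_mul, map_sum,
      ← Finset.sum_add_distrib]
    refine Finset.sum_congr rfl fun i _ => ?_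
    rw [gaussExp_X_mul, Derivation.leibniz, map_add]
    simp only [smul_eq_mul, mul_comm q]
  have h3 : 2 * gaussExp ι (L * q) ≤ gaussExp ι (L * L) + gaussExp ι (q * q) := by
    have := gaussExp_mul_self_nonneg (L - q)
    have h4 : (L - q) * (L - q) = L * L + q * q - (2 : ℝ) • (L * q) := by
      rw [two_smul]; ring
    rw [h4, map_sub, map_add, map_smul, smul_eq_mul] at this
    linarith
  have h5 : gaussExp ι (q * q) ≤ k * gaussExp ι (q * q) :=
    le_mul_of_one_le_left (gaussExp_mul_self_nonneg q) (by exact_mod_cast hk)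
  linarith

/-- Iterates the energy inequality down in degree. A gradient lowers the degree by one at no cost in
dimension; a Laplacian lowers it by two and costs one factor of the dimension. Hence the exponent
⌊k/2⌋. -/
theorem exists_gaussExp_mul_self_le (k : ℕ) : ∃ B : ℝ, 0 ≤ B ∧
    ∀ (ι : Type) [Fintype ι] (q : MvPolynomial ι ℝ), q.IsHomogeneous k →
      gaussExp ι (q * q) ≤ B * (Fintype.card ι : ℝ) ^ (k / 2) * fischerSq q := by
  induction k using Nat.strong_induction_on with
  | _ k ih =>
  rcases Nat.eq_zero_or_pos k with rfl | hk
  · refine ⟨1, zero_le_one, fun ι _ q hq => ?_⟩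
    rw [← totalDegree_zero_iff_isHomogeneous, totalDegree_eq_zero_iff_eq_C] at hq
    rw [fischerSq, hq, ← mul_one (C _), ← smul_eq_C_mul, map_smul, hermiteMap_one]
    simp
  · obtain ⟨B₁, hB₁, h₁⟩ := ih (k - 1) (by omega)
    obtain ⟨B₂, hB₂, h₂⟩ : ∃ B : ℝ, 0 ≤ B ∧ ∀ (ι : Type) [Fintype ι] (q : MvPolynomial ι ℝ),
        q.IsHomogeneous k →
        gaussExp ι ((∑ i, pderiv i (pderiv i q)) * ∑ i, pderiv i (pderiv i q)) ≤
          B * (Fintype.card ι : ℝ) ^ (k / 2) * fischerSq q := by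
      rcases Nat.lt_or_ge k 2 with h | h
      · obtain rfl : k = 1 := by omega
        refine ⟨0, le_rfl, fun ι _ q hq => ?_⟩
        have : ∀ i, pderiv i (pderiv i q) = 0 := by
          intro i
          have h0 : (pderiv i q).IsHomogeneous 0 := hq.pderiv
          rw [← totalDegree_zero_iff_isHomogeneous, totalDegree_eq_zero_iff_eq_C] at h0
          rw [h0, pderiv_C]
        simp [this]
      · obtain ⟨B, hB, hb⟩ := ih (k - 2) (by omega)
        refine ⟨B * (k * (k - 1 : ℕ)), by positivity, fun ι _ q hq => ?_⟩
        have hL : (∑ i, pderiv i (pderiv i q)).IsHomogeneous (k - 2) :=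
          IsHomogeneous.sum _ _ _ fun i _ => by
            have := (hq.pderiv (i := i)).pderiv (i := i)
            rwa [Nat.sub_sub] at this
        have hk2 : k / 2 = (k - 2) / 2 + 1 := by omega
        calc _ ≤ B * (Fintype.card ι : ℝ) ^ ((k - 2) / 2) * _ := hb ι _ hL
          _ ≤ B * (Fintype.card ι : ℝ) ^ ((k - 2) / 2) *
              (Fintype.card ι * (k * (k - 1 : ℕ) * fischerSq q)) := by
            gcongr
            exact fischerSq_sum_pderiv_pderiv_le hq
          _ = _ := by rw [hk2, pow_succ]; ring
    refine ⟨2 * (B₁ * k) + B₂, by positivity, fun ι _ q hq => ?_⟩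
    refine (gaussExp_mul_self_energy hq hk).trans ?_
    have h3 : ∑ i, gaussExp ι (pderiv i q * pderiv i q) ≤
        B₁ * k * (Fintype.card ι : ℝ) ^ (k / 2) * fischerSq q := by
      rcases isEmpty_or_nonempty ι with hι | hι
      · simp only [Finset.univ_eq_empty, Finset.sum_empty]
        have := fischerSq_nonneg q
        positivity
      · have hcard : (1 : ℝ) ≤ Fintype.card ι := by exact_mod_cast Fintype.card_pos
        calc ∑ i, gaussExp ι (pderiv i q * pderiv i q)
            ≤ ∑ i, B₁ * (Fintype.card ι : ℝ) ^ ((k - 1) / 2) * fischerSq (pderiv i q) :=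
              Finset.sum_le_sum fun i _ => h₁ ι _ hq.pderiv
          _ = B₁ * (Fintype.card ι : ℝ) ^ ((k - 1) / 2) * (k * fischerSq q) := by
              rw [← Finset.mul_sum, sum_fischerSq_pderiv hq]
          _ ≤ B₁ * (Fintype.card ι : ℝ) ^ (k / 2) * (k * fischerSq q) := by
              have := fischerSq_nonneg q
              gcongr
              omega
          _ = _ := by ring
    have := h₂ ι q hq
    calc _ ≤ 2 * (B₁ * k * (Fintype.card ι : ℝ) ^ (k / 2) * fischerSq q) +
        B₂ * (Fintype.card ι : ℝ) ^ (k / 2) * fischerSq q := by gcongr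
      _ = _ := by ring

end GaussianPolynomials

/-! ### Invariance of the Gaussian measure -/

section GaussianInvariance

open Matrix

/-- By characteristic functions: that of the image at t is the Gaussian one at Mᵀt, and |Mᵀt| = |t|.
-/
theorem measurePreserving_mulVec_gauss {ι κ : Type*} [Fintype ι] [Fintype κ] [DecidableEq κ]
    {M : Matrix κ ι ℝ} (hM : M * Mᵀ = 1) :
    MeasurePreserving (fun x => M *ᵥ x) (gauss ι) (gauss κ) := by
  have hmeas : Measurable fun x : ι → ℝ => M *ᵥ x := by
    refine Continuous.measurable ?_
    fun_prop
  refine ⟨hmeas, ?_⟩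
  have hinj : Function.Injective (Measure.map (WithLp.toLp 2 : (κ → ℝ) → EuclideanSpace ℝ κ)) := by
    intro μ ν h
    have := congrArg (Measure.map (WithLp.ofLp : EuclideanSpace ℝ κ → (κ → ℝ))) h
    rwa [Measure.map_map (by fun_prop) (by fun_prop), Measure.map_map (by fun_prop) (by fun_prop),
      show (WithLp.ofLp : EuclideanSpace ℝ κ → (κ → ℝ)) ∘ WithLp.toLp 2 = id from rfl,
      Measure.map_id, Measure.map_id] at this
  apply hinj
  rw [gauss, gauss, map_pi_eq_stdGaussian, Measure.map_map (by fun_prop) hmeas]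
  have : IsFiniteMeasure (Measure.map ((WithLp.toLp 2 : (κ → ℝ) → EuclideanSpace ℝ κ) ∘
      fun x => M *ᵥ x) (Measure.pi fun _ : ι => gaussianReal 0 1)) :=
    Measure.isFiniteMeasure_map _ _
  apply Measure.ext_of_charFun (E := EuclideanSpace ℝ κ)
  ext t
  rw [charFun_stdGaussian, charFun_apply, integral_map (by fun_prop) (by fun_prop)]
  have h1 := charFun_stdGaussian (WithLp.toLp 2 (Mᵀ *ᵥ t.ofLp) : EuclideanSpace ℝ ι)
  rw [charFun_apply, ← map_pi_eq_stdGaussian, integral_map (by fun_prop) (by fun_prop)] at h1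
  have h2 : ‖(WithLp.toLp 2 (Mᵀ *ᵥ t.ofLp) : EuclideanSpace ℝ ι)‖ ^ 2 = ‖t‖ ^ 2 := by
    rw [← real_inner_self_eq_norm_sq, ← real_inner_self_eq_norm_sq,
      EuclideanSpace.inner_eq_star_dotProduct, EuclideanSpace.inner_eq_star_dotProduct]
    simp only [star_trivial]
    rw [Matrix.dotProduct_mulVec, Matrix.vecMul_transpose, Matrix.mulVec_mulVec, hM,
      Matrix.one_mulVec]
  rw [← Complex.ofReal_pow, h2, Complex.ofReal_pow] at h1
  rw [← h1]
  refine integral_congr_ae (ae_of_all _ fun x => ?_)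
  simp only [Function.comp_apply, EuclideanSpace.inner_eq_star_dotProduct, star_trivial]
  congr 3
  rw [Matrix.dotProduct_mulVec, dotProduct_comm, ← Matrix.mulVec_transpose]
  exact dotProduct_comm _ _

/-- The Householder reflection along v - w; equality of norms gives 2 u·v = u·u. -/
theorem exists_orthogonal_mulVec_eq {d : ℕ} {v w : Fin d → ℝ} (h : v ⬝ᵥ v = w ⬝ᵥ w) :
    ∃ U ∈ Matrix.orthogonalGroup (Fin d) ℝ, U *ᵥ v = w := by
  by_cases hvw : v = w
  · exact ⟨1, one_mem _, by simp [hvw]⟩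
  set u := v - w with hu
  have hu0 : u ⬝ᵥ u ≠ 0 := by
    rw [Ne, dotProduct_self_eq_zero, hu, sub_eq_zero]; exact hvw
  have huv : 2 * (u ⬝ᵥ v) = u ⬝ᵥ u := by
    simp only [hu, sub_dotProduct, dotProduct_sub]
    rw [h, dotProduct_comm w v]; ring
  have hsymm : (1 - (2 / (u ⬝ᵥ u)) • vecMulVec u u)ᵀ = 1 - (2 / (u ⬝ᵥ u)) • vecMulVec u u := by
    rw [transpose_sub, transpose_one, transpose_smul, transpose_vecMulVec]
  refine ⟨1 - (2 / (u ⬝ᵥ u)) • vecMulVec u u, ?_, ?_⟩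
  · rw [Matrix.mem_orthogonalGroup_iff]
    rw [hsymm]
    have h1 : vecMulVec u u * vecMulVec u u = (u ⬝ᵥ u) • vecMulVec u u := by
      rw [vecMulVec_mul_vecMulVec]
      ext i j; simp [vecMulVec_apply]; ring
    rw [sub_mul, mul_sub, mul_sub, one_mul, one_mul, mul_one, smul_mul_assoc, mul_smul_comm, h1,
      smul_smul, smul_smul]
    have h2 : 2 / (u ⬝ᵥ u) * (2 / (u ⬝ᵥ u)) * (u ⬝ᵥ u) = 2 / (u ⬝ᵥ u) + 2 / (u ⬝ᵥ u) := by
      field_simp; norm_num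
    rw [h2, add_smul]
    abel
  · rw [sub_mulVec, one_mulVec, smul_mulVec, vecMulVec_mulVec]
    have h3 : (2 / (u ⬝ᵥ u)) • MulOpposite.op (u ⬝ᵥ v) • u = u := by
      ext i
      simp only [Pi.smul_apply, smul_eq_mul, MulOpposite.smul_eq_mul_unop, MulOpposite.unop_op]
      field_simp
      linear_combination u i * huv
    rw [h3, hu]; abel

end GaussianInvariance

/-! ### Pairings of an `L²` function with Hermite polynomials -/

section Pairing

open MvPolynomial

variable {ι : Type*} [Fintype ι]

theorem memLp_eval_gauss (q : MvPolynomial ι ℝ) :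
    MemLp (fun x : ι → ℝ => eval x q) 2 (gauss ι) := by
  rw [memLp_two_iff_integrable_sq (MvPolynomial.continuous_eval q).aestronglyMeasurable]
  exact (integrable_eval_gauss (q ^ 2)).congr (ae_of_all _ fun x => map_pow (eval x) q 2)

/-- The pairing `q ↦ E[φ · H(q)]` with the Hermite image of a polynomial. -/
noncomputable def hermitePairing {φ : (ι → ℝ) → ℝ} (hφ : MemLp φ 2 (gauss ι)) :
    MvPolynomial ι ℝ →ₗ[ℝ] ℝ where
  toFun q := ∫ x, φ x * eval x (hermiteMap q) ∂(gauss ι)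
  map_add' p q := by
    simp only [map_add, mul_add]
    exact integral_add (hφ.integrable_mul (memLp_eval_gauss _))
      (hφ.integrable_mul (memLp_eval_gauss _))
  map_smul' a q := by
    simp only [map_smul, smul_eval, mul_left_comm _ a]
    exact integral_const_mul _ _

theorem hermitePairing_apply {φ : (ι → ℝ) → ℝ} (hφ : MemLp φ 2 (gauss ι)) (q : MvPolynomial ι ℝ) :
    hermitePairing hφ q = ∫ x, φ x * eval x (hermiteMap q) ∂(gauss ι) := rfl

theorem sq_integral_mul_le {Ω : Type*} [MeasurableSpace Ω] {μ : Measure Ω} {f g : Ω → ℝ}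
    (hf : MemLp f 2 μ) (hg : MemLp g 2 μ) :
    (∫ x, f x * g x ∂μ) ^ 2 ≤ (∫ x, f x ^ 2 ∂μ) * ∫ x, g x ^ 2 ∂μ := by
  have hfg : Integrable (fun x => f x * g x) μ := hf.integrable_mul hg
  have key : ∀ t : ℝ, 0 ≤ (∫ x, g x ^ 2 ∂μ) * (t * t) + (2 * ∫ x, f x * g x ∂μ) * t +
      ∫ x, f x ^ 2 ∂μ := by
    intro t
    have h1 : ∫ x, (f x + t * g x) ^ 2 ∂μ = (∫ x, g x ^ 2 ∂μ) * (t * t) +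
        (2 * ∫ x, f x * g x ∂μ) * t + ∫ x, f x ^ 2 ∂μ := by
      have : ∀ x, (f x + t * g x) ^ 2 = (t * t) * g x ^ 2 + (2 * t) * (f x * g x) + f x ^ 2 :=
        fun x => by ring
      have h2 : Integrable (fun x => (t * t) * g x ^ 2 + (2 * t) * (f x * g x)) μ :=
        ((hg.integrable_sq).const_mul _).add (hfg.const_mul _)
      simp_rw [this]
      rw [integral_add h2 hf.integrable_sq,
        integral_add ((hg.integrable_sq).const_mul _) (hfg.const_mul _), integral_const_mul,
        integral_const_mul]
      ring
    rw [← h1]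
    exact integral_nonneg fun x => sq_nonneg _
  have := discrim_le_zero key
  rw [discrim] at this
  nlinarith

theorem sq_hermitePairing_le {φ : (ι → ℝ) → ℝ} (hφ : MemLp φ 2 (gauss ι)) (q : MvPolynomial ι ℝ) :
    hermitePairing hφ q ^ 2 ≤ (∫ x, φ x ^ 2 ∂(gauss ι)) * fischerSq q := by
  have := sq_integral_mul_le hφ (memLp_eval_gauss (hermiteMap q))
  rw [hermitePairing_apply, fischerSq, gaussExp_apply]
  simpa [pow_two] using this

theorem hermiteMap_prod_X_pow (β : ι → ℕ) :
    hermiteMap (∏ i, (X i : MvPolynomial ι ℝ) ^ β i) = hermiteMv β := by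
  have := hermiteMap_monomial (Finsupp.equivFunOnFinite.symm β) 1
  rw [one_smul, monomial_eq, Finsupp.prod_fintype _ _ (by simp)] at this
  simpa using this

theorem gaussExp_hermiteMv_self (β : ι → ℕ) :
    gaussExp ι (hermiteMv β * hermiteMv β) = ∏ i, ((β i).factorial : ℝ) := by
  simpa using gaussExp_hermiteMv_mul_hermiteMv (Finsupp.equivFunOnFinite.symm β)
    (Finsupp.equivFunOnFinite.symm β)

theorem gaussExp_hermiteMv_of_ne {β γ : ι → ℕ} (h : β ≠ γ) :
    gaussExp ι (hermiteMv β * hermiteMv γ) = 0 := by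
  have := gaussExp_hermiteMv_mul_hermiteMv (Finsupp.equivFunOnFinite.symm β)
    (Finsupp.equivFunOnFinite.symm γ)
  rw [if_neg (by simpa using h)] at this
  simpa using this

/-- The degree-`k` Hermite part of `φ` as a homogeneous polynomial. -/
theorem exists_isHomogeneous_eval_eq_hermitePairing {φ : (ι → ℝ) → ℝ}
    (hφ : MemLp φ 2 (gauss ι)) (k : ℕ) :
    ∃ p : MvPolynomial ι ℝ, p.IsHomogeneous k ∧
      (∀ v, eval v p = hermitePairing hφ (linForm v ^ k)) ∧
      fischerSq p ≤ (k.factorial : ℝ) ^ 2 * ∫ x, φ x ^ 2 ∂(gauss ι) := by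
  classical
  set I := Finset.piAntidiag (Finset.univ : Finset ι) k with hI
  set a : (ι → ℕ) → ℝ := fun β => hermitePairing hφ (∏ i, (X i : MvPolynomial ι ℝ) ^ β i) with ha
  set m : (ι → ℕ) → ℝ := fun β => (Nat.multinomial Finset.univ β : ℝ) with hm
  -- The multinomial weights make evaluation at v reproduce the expansion of `linForm v ^ k`. They
  -- also cancel the factorials in the Hermite norms down to k!, which gives `hfis`.
  set p : MvPolynomial ι ℝ := ∑ β ∈ I, (m β * a β) • ∏ i, (X i : MvPolynomial ι ℝ) ^ β i with hp
  have hp_map : hermiteMap p = ∑ β ∈ I, (m β * a β) • hermiteMv β := by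
    rw [hp, map_sum]
    exact Finset.sum_congr rfl fun β _ => by rw [map_smul, hermiteMap_prod_X_pow]
  have hmk : ∀ β ∈ I, m β * ∏ i, ((β i).factorial : ℝ) = k.factorial := by
    intro β hβ
    rw [hI, Finset.mem_piAntidiag] at hβ
    have := Nat.multinomial_spec Finset.univ β
    rw [hβ.1] at this
    rw [hm, ← this]; push_cast; ring
  have hpair : hermitePairing hφ p = ∑ β ∈ I, m β * a β ^ 2 := by
    rw [hp, map_sum]
    refine Finset.sum_congr rfl fun β _ => ?_
    rw [map_smul, smul_eq_mul]; ring
  have hfis : fischerSq p = k.factorial * hermitePairing hφ p := by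
    rw [fischerSq, hp_map, Finset.sum_mul, map_sum, hpair, Finset.mul_sum]
    refine Finset.sum_congr rfl fun β hβ => ?_
    rw [Finset.mul_sum, map_sum, Finset.sum_eq_single β]
    · rw [smul_mul_smul_comm, map_smul, gaussExp_hermiteMv_self, smul_eq_mul, ← hmk β hβ]
      ring
    · intro γ _ hγ
      rw [smul_mul_smul_comm, map_smul, gaussExp_hermiteMv_of_ne hγ.symm, smul_zero]
    · exact fun h => absurd hβ h
  refine ⟨p, ?_, ?_, ?_⟩
  · refine IsHomogeneous.sum _ _ _ fun β hβ => ?_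
    rw [hI, Finset.mem_piAntidiag] at hβ
    rw [smul_eq_C_mul]
    refine IsHomogeneous.C_mul ?_ _
    have := IsHomogeneous.prod Finset.univ (fun i => (X i : MvPolynomial ι ℝ) ^ β i) β
      fun i _ => by simpa using (isHomogeneous_X ℝ i).pow (β i)
    rwa [hβ.1] at this
  · intro v
    rw [linForm, Finset.sum_pow_eq_sum_piAntidiag, map_sum, map_sum]
    refine Finset.sum_congr rfl fun β _ => ?_
    have : ((Nat.multinomial Finset.univ β : ℕ) : MvPolynomial ι ℝ) *
        ∏ i, (C (v i) * X i) ^ β i = (m β * ∏ i, v i ^ β i) • ∏ i, (X i : MvPolynomial ι ℝ) ^ β i := by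
      simp only [mul_pow, Finset.prod_mul_distrib, smul_eq_C_mul, map_mul, map_prod, map_pow, hm,
        map_natCast]
      ring
    rw [this, smul_eval, map_smul, map_prod, smul_eq_mul]
    simp only [map_pow, eval_X, ha]
    ring
  · have h1 := sq_hermitePairing_le hφ p
    have h2 : (0 : ℝ) < k.factorial := by positivity
    have h3 := fischerSq_nonneg p
    rcases h3.eq_or_lt with h0 | h0
    · rw [← h0]
      have : 0 ≤ ∫ x, φ x ^ 2 ∂(gauss ι) := integral_nonneg fun x => sq_nonneg _
      positivity
    · have h4 : fischerSq p * fischerSq p ≤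
          ((k.factorial : ℝ) ^ 2 * ∫ x, φ x ^ 2 ∂(gauss ι)) * fischerSq p := by
        nth_rw 1 2 [hfis]
        nlinarith [mul_le_mul_of_nonneg_left h1 (sq_nonneg (k.factorial : ℝ))]
      exact le_of_mul_le_mul_right h4 h0

end Pairing

/-! ### Averages over the orthogonal group -/

section HaarAverage

open MvPolynomial

open scoped Matrix

instance haarOrthogonal_isMulLeftInvariant (d : ℕ) : (haarOrthogonal d).IsMulLeftInvariant := by
  unfold haarOrthogonal; infer_instance

theorem stdGauss_eq_gauss (d : ℕ) : stdGauss d = gauss (Fin d) := rfl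

theorem continuous_eval_transpose_mulVec {d : ℕ} (p : MvPolynomial (Fin d) ℝ) :
    Continuous fun z : Matrix.orthogonalGroup (Fin d) ℝ × (Fin d → ℝ) =>
      eval ((z.1 : Matrix (Fin d) (Fin d) ℝ)ᵀ *ᵥ z.2) p := by
  refine (MvPolynomial.continuous_eval p).comp ?_
  fun_prop

theorem coe_mul_transpose_self {d : ℕ} (R : Matrix.orthogonalGroup (Fin d) ℝ) :
    (R : Matrix (Fin d) (Fin d) ℝ) * (R : Matrix (Fin d) (Fin d) ℝ)ᵀ = 1 :=
  (Matrix.mem_orthogonalGroup_iff (Fin d) ℝ).mp R.2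

theorem transpose_mul_coe_self {d : ℕ} (R : Matrix.orthogonalGroup (Fin d) ℝ) :
    (R : Matrix (Fin d) (Fin d) ℝ)ᵀ * (R : Matrix (Fin d) (Fin d) ℝ) = 1 :=
  (Matrix.mem_orthogonalGroup_iff' (Fin d) ℝ).mp R.2

/-- The average of `p(Rᵀ v)²` over Haar-distributed `R`. -/
noncomputable def haarAvg {d : ℕ} (p : MvPolynomial (Fin d) ℝ) (v : Fin d → ℝ) : ENNReal :=
  ∫⁻ R, ENNReal.ofReal (eval ((R : Matrix (Fin d) (Fin d) ℝ)ᵀ *ᵥ v) p ^ 2) ∂(haarOrthogonal d)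

/-- O(d) is transitive on spheres, and a rotation of v is absorbed into R by left invariance. -/
theorem haarAvg_congr {d : ℕ} (p : MvPolynomial (Fin d) ℝ) {v w : Fin d → ℝ}
    (h : v ⬝ᵥ v = w ⬝ᵥ w) : haarAvg p v = haarAvg p w := by
  obtain ⟨U, hU, rfl⟩ := exists_orthogonal_mulVec_eq h
  unfold haarAvg
  rw [← lintegral_mul_left_eq_self (μ := haarOrthogonal d)
    (fun R => ENNReal.ofReal (eval ((R : Matrix (Fin d) (Fin d) ℝ)ᵀ *ᵥ (U *ᵥ v)) p ^ 2)) ⟨U, hU⟩]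
  refine lintegral_congr fun R => ?_
  congr 4
  rw [Submonoid.coe_mul, Matrix.transpose_mul, Matrix.mulVec_mulVec, Matrix.mul_assoc]
  have := transpose_mul_coe_self ⟨U, hU⟩
  simp only at this
  rw [this, Matrix.mul_one]

theorem eval_smul_of_isHomogeneous {ι : Type*} [Fintype ι] {p : MvPolynomial ι ℝ} {k : ℕ}
    (hp : p.IsHomogeneous k) (t : ℝ) (v : ι → ℝ) : eval (t • v) p = t ^ k * eval v p := by
  rw [eval_eq', eval_eq', Finset.mul_sum]
  refine Finset.sum_congr rfl fun β hβ => ?_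
  have hk : ∑ i, β i = k := by
    have := hp (mem_support_iff.1 hβ)
    rw [← this, Finsupp.weight_apply, Finsupp.sum_fintype _ _ (by simp)]
    simp
  simp only [Pi.smul_apply, smul_eq_mul, mul_pow, Finset.prod_mul_distrib, Finset.prod_pow_eq_pow_sum,
    hk]
  ring

theorem haarAvg_smul {d : ℕ} {p : MvPolynomial (Fin d) ℝ} {k : ℕ} (hp : p.IsHomogeneous k)
    (t : ℝ) (v : Fin d → ℝ) :
    haarAvg p (t • v) = ENNReal.ofReal ((t ^ 2) ^ k) * haarAvg p v := by
  unfold haarAvg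
  rw [← lintegral_const_mul' _ _ ENNReal.ofReal_ne_top]
  refine lintegral_congr fun R => ?_
  rw [← ENNReal.ofReal_mul (by positivity), Matrix.mulVec_smul, eval_smul_of_isHomogeneous hp]
  congr 1; ring

/-- Scaling each vector by the norm of the other makes the norms equal without a division, so zero
vectors need no separate case. -/
theorem haarAvg_mul_comm {d : ℕ} {p : MvPolynomial (Fin d) ℝ} {k : ℕ} (hp : p.IsHomogeneous k)
    (v w : Fin d → ℝ) :
    ENNReal.ofReal ((v ⬝ᵥ v) ^ k) * haarAvg p w = ENNReal.ofReal ((w ⬝ᵥ w) ^ k) * haarAvg p v := by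
  have hv : 0 ≤ v ⬝ᵥ v := Finset.sum_nonneg fun i _ => mul_self_nonneg _
  have hw : 0 ≤ w ⬝ᵥ w := Finset.sum_nonneg fun i _ => mul_self_nonneg _
  have h := haarAvg_congr p (v := √(v ⬝ᵥ v) • w) (w := √(w ⬝ᵥ w) • v) (by
    simp only [smul_dotProduct, dotProduct_smul, smul_eq_mul, ← mul_assoc, Real.mul_self_sqrt hv,
      Real.mul_self_sqrt hw]
    ring)
  rwa [haarAvg_smul hp, haarAvg_smul hp, Real.sq_sqrt hv, Real.sq_sqrt hw] at h

theorem lintegral_haarAvg {d : ℕ} (p : MvPolynomial (Fin d) ℝ) :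
    ∫⁻ g, haarAvg p g ∂(gauss (Fin d)) = ENNReal.ofReal (gaussExp (Fin d) (p * p)) := by
  unfold haarAvg
  rw [lintegral_lintegral_swap]
  · have : ∀ R : Matrix.orthogonalGroup (Fin d) ℝ, ∫⁻ g : Fin d → ℝ,
        ENNReal.ofReal (eval ((R : Matrix (Fin d) (Fin d) ℝ)ᵀ *ᵥ g) p ^ 2) ∂(gauss (Fin d)) =
        ENNReal.ofReal (gaussExp (Fin d) (p * p)) := by
      intro R
      have hR : (R : Matrix (Fin d) (Fin d) ℝ)ᵀ * (R : Matrix (Fin d) (Fin d) ℝ)ᵀᵀ = 1 := by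
        rw [Matrix.transpose_transpose]; exact transpose_mul_coe_self R
      rw [(measurePreserving_mulVec_gauss hR).lintegral_comp
        (f := fun x => ENNReal.ofReal (eval x p ^ 2))
        (((MvPolynomial.continuous_eval p).pow 2).measurable.ennreal_ofReal),
        ← ofReal_integral_eq_lintegral_ofReal _ (ae_of_all _ fun x => sq_nonneg _), gaussExp_apply]
      · simp [pow_two]
      · exact (memLp_eval_gauss p).integrable_sq
    simp [this]
  · refine Measurable.aemeasurable (Measurable.ennreal_ofReal ?_)
    exact (((continuous_eval_transpose_mulVec p).comp continuous_swap).pow 2).measurable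

/-- Jensen's inequality for t ↦ t^k, with E|g|² = d. -/
theorem pow_card_le_integral_dotProduct_pow (d k : ℕ) :
    ENNReal.ofReal ((d : ℝ) ^ k) ≤ ∫⁻ g : Fin d → ℝ, ENNReal.ofReal ((g ⬝ᵥ g) ^ k)
      ∂(gauss (Fin d)) := by
  set s : MvPolynomial (Fin d) ℝ := ∑ i, X i * X i with hs
  have hev : ∀ g : Fin d → ℝ, eval g s = g ⬝ᵥ g := by intro g; simp [hs, dotProduct]
  have hnn : ∀ g : Fin d → ℝ, 0 ≤ g ⬝ᵥ g := fun g =>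
    Finset.sum_nonneg fun i _ => mul_self_nonneg _
  have h1 : ∫ g, eval g s ∂(gauss (Fin d)) = d := by
    rw [← gaussExp_apply, hs, map_sum]
    simp [gaussExp_X_mul, gaussExp_one]
  have hint : Integrable (fun g => eval g s ^ k) (gauss (Fin d)) :=
    (integrable_eval_gauss (s ^ k)).congr (ae_of_all _ fun x => map_pow (eval x) s k)
  have h2 := (convexOn_pow k).map_integral_le (μ := gauss (Fin d)) (f := fun g => eval g s)
    (by fun_prop) isClosed_Ici (ae_of_all _ fun g => by
      rw [Set.mem_Ici, hev]; exact hnn g) (integrable_eval_gauss s) hint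
  rw [h1] at h2
  simp only [← hev]
  rw [← ofReal_integral_eq_lintegral_ofReal hint
    (ae_of_all _ fun g => pow_nonneg (by rw [hev]; exact hnn g) k)]
  exact ENNReal.ofReal_le_ofReal h2

/-- Integrates `haarAvg_mul_comm` over a Gaussian vector: the Haar average at c is thereby
controlled by a Gaussian moment of p. -/
theorem pow_mul_haarAvg_le {d : ℕ} {p : MvPolynomial (Fin d) ℝ} {k : ℕ} (hp : p.IsHomogeneous k)
    (c : Fin d → ℝ) :
    ENNReal.ofReal ((d : ℝ) ^ k) * haarAvg p c ≤
      ENNReal.ofReal ((c ⬝ᵥ c) ^ k * gaussExp (Fin d) (p * p)) := by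
  have hc : 0 ≤ c ⬝ᵥ c := Finset.sum_nonneg fun i _ => mul_self_nonneg _
  calc _ ≤ (∫⁻ g : Fin d → ℝ, ENNReal.ofReal ((g ⬝ᵥ g) ^ k) ∂(gauss (Fin d))) * haarAvg p c := by
        gcongr
        exact pow_card_le_integral_dotProduct_pow d k
    _ = ∫⁻ g : Fin d → ℝ, ENNReal.ofReal ((g ⬝ᵥ g) ^ k) * haarAvg p c ∂(gauss (Fin d)) := by
        rw [lintegral_mul_const]
        refine Measurable.ennreal_ofReal (Continuous.measurable ?_)
        simp only [dotProduct]
        fun_prop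
    _ = ∫⁻ g : Fin d → ℝ, ENNReal.ofReal ((c ⬝ᵥ c) ^ k) * haarAvg p g ∂(gauss (Fin d)) :=
        lintegral_congr fun g => haarAvg_mul_comm hp g c
    _ = _ := by
        rw [lintegral_const_mul' _ _ ENNReal.ofReal_ne_top, lintegral_haarAvg,
          ENNReal.ofReal_mul (by positivity)]

theorem linForm_add {ι : Type*} [Fintype ι] (v w : ι → ℝ) :
    linForm (v + w) = linForm v + linForm w := by
  simp [linForm, add_mul, Finset.sum_add_distrib]

theorem linForm_smul {ι : Type*} [Fintype ι] (a : ℝ) (v : ι → ℝ) :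
    linForm (a • v) = C a * linForm v := by
  simp [linForm, Finset.mul_sum, mul_assoc]

theorem linForm_sum {ι κ : Type*} [Fintype ι] (s : Finset κ) (v : κ → ι → ℝ) :
    linForm (∑ j ∈ s, v j) = ∑ j ∈ s, linForm (v j) := by
  classical
  induction s using Finset.induction_on with
  | empty => simp [linForm]
  | insert a s ha ih => rw [Finset.sum_insert ha, Finset.sum_insert ha, linForm_add, ih]

/-- Rows are Rᵀ applied to basis vectors, so polarization leaves only powers of forms Rᵀc with c
fixed, the shape that `haarAvg` handles. -/
theorem prod_linForm_row {d k : ℕ} (f : Fin k → Fin d) (R : Matrix (Fin d) (Fin d) ℝ) :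
    ∏ j, linForm (R (f j)) = ((2 ^ k * k.factorial : ℕ) : ℝ)⁻¹ • ∑ ε : Fin k → ℤˣ,
      (∏ i, ((ε i : ℤ) : ℝ)) • linForm (Rᵀ *ᵥ ∑ j, ((ε j : ℤ) : ℝ) • Pi.single (f j) 1) ^ k := by
  have h := sum_sign_mul_sum_pow k fun j => linForm (R (f j))
  have h0 : ((2 ^ k * k.factorial : ℕ) : ℝ) ≠ 0 := by positivity
  rw [eq_inv_smul_iff₀ h0, smul_eq_C_mul, map_natCast, ← h]
  refine Finset.sum_congr rfl fun ε _ => ?_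
  have h1 : Rᵀ *ᵥ ∑ j, ((ε j : ℤ) : ℝ) • (Pi.single (f j) 1 : Fin d → ℝ) =
      ∑ j, ((ε j : ℤ) : ℝ) • R (f j) := by
    rw [Matrix.mulVec_sum]
    refine Finset.sum_congr rfl fun j _ => ?_
    rw [Matrix.mulVec_smul, Matrix.mulVec_single_one]
    rfl
  rw [h1, linForm_sum, smul_eq_C_mul, map_prod]
  simp only [linForm_smul, map_intCast]

theorem dotProduct_self_signed_le {d k : ℕ} (f : Fin k → Fin d) (ε : Fin k → ℤˣ) :
    (∑ j, ((ε j : ℤ) : ℝ) • (Pi.single (f j) 1 : Fin d → ℝ)) ⬝ᵥ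
      (∑ j, ((ε j : ℤ) : ℝ) • (Pi.single (f j) 1 : Fin d → ℝ)) ≤ (k : ℝ) ^ 2 := by
  rw [sum_dotProduct]
  calc _ ≤ ∑ _i : Fin k, (k : ℝ) := by
        refine Finset.sum_le_sum fun i _ => ?_
        rw [dotProduct_sum]
        calc _ ≤ ∑ _j : Fin k, (1 : ℝ) := by
              refine Finset.sum_le_sum fun j _ => ?_
              rw [smul_dotProduct, dotProduct_smul, single_dotProduct]
              rcases Int.units_eq_one_or (ε i) with h | h <;>
                rcases Int.units_eq_one_or (ε j) with h' | h' <;>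
                simp only [h, h', Pi.single_apply] <;> split_ifs <;> norm_num
          _ = k := by simp
    _ = (k : ℝ) ^ 2 := by simp [pow_two]

theorem exists_lintegral_sq_hermitePairing_prod_linForm_le (k : ℕ) : ∃ C : ℝ, 0 ≤ C ∧
    ∀ (d : ℕ) (f : Fin k → Fin d) (φ : (Fin d → ℝ) → ℝ) (hφ : MemLp φ 2 (gauss (Fin d))),
      ∫⁻ R, ENNReal.ofReal (hermitePairing hφ
        (∏ j, linForm ((R : Matrix (Fin d) (Fin d) ℝ) (f j))) ^ 2) ∂(haarOrthogonal d) ≤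
      ENNReal.ofReal (C * ((d : ℝ) ^ ((k + 1) / 2))⁻¹ * ∫ x, φ x ^ 2 ∂(gauss (Fin d))) := by
  obtain ⟨B, hB, hb⟩ := exists_gaussExp_mul_self_le k
  set N : ℝ := ((2 ^ k * k.factorial : ℕ) : ℝ)⁻¹ with hN
  set C₁ : ℝ := ((k : ℝ) ^ 2) ^ k * (B * (k.factorial : ℝ) ^ 2) with hC₁
  refine ⟨N ^ 2 * 2 ^ k * (2 ^ k * C₁), by positivity, fun d f φ hφ => ?_⟩
  set I := ∫ x, φ x ^ 2 ∂(gauss (Fin d)) with hI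
  have hI0 : 0 ≤ I := integral_nonneg fun x => sq_nonneg _
  obtain ⟨p, hp, hpe, hpf⟩ := exists_isHomogeneous_eval_eq_hermitePairing hφ k
  -- ⌊k/2⌋ + ⌈k/2⌉ = k. For k > 0 the map `f` forces d > 0; for k = 0 all powers are 1.
  have hd : (d : ℝ) ^ k ≠ 0 ∧ (d : ℝ) ^ (k / 2) = (d : ℝ) ^ k * ((d : ℝ) ^ ((k + 1) / 2))⁻¹ := by
    rcases Nat.eq_zero_or_pos k with rfl | hk
    · simp
    · have : 0 < d := (Nat.zero_le _).trans_lt (f ⟨0, hk⟩).2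
      have h' : (0 : ℝ) < d := by exact_mod_cast this
      refine ⟨by positivity, ?_⟩
      rw [eq_mul_inv_iff_mul_eq₀ (by positivity), ← pow_add]
      congr 1; omega
  have havg : ∀ c : Fin d → ℝ, c ⬝ᵥ c ≤ (k : ℝ) ^ 2 →
      haarAvg p c ≤ ENNReal.ofReal (C₁ * ((d : ℝ) ^ ((k + 1) / 2))⁻¹ * I) := by
    intro c hc
    have hc0 : 0 ≤ c ⬝ᵥ c := Finset.sum_nonneg fun i _ => mul_self_nonneg _
    have hdk : (0 : ℝ) < (d : ℝ) ^ k := lt_of_le_of_ne (by positivity) hd.1.symm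
    have h1 := pow_mul_haarAvg_le hp c
    have h2 : (c ⬝ᵥ c) ^ k * gaussExp (Fin d) (p * p) ≤
        (d : ℝ) ^ k * (C₁ * ((d : ℝ) ^ ((k + 1) / 2))⁻¹ * I) := by
      have h3 := hb (Fin d) p hp
      rw [Fintype.card_fin] at h3
      have h4 := gaussExp_mul_self_nonneg p
      calc _ ≤ ((k : ℝ) ^ 2) ^ k * (B * (d : ℝ) ^ (k / 2) * ((k.factorial : ℝ) ^ 2 * I)) := by
            gcongr
            exact h3.trans (by gcongr)
        _ = _ := by rw [hd.2, hC₁]; ring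
    have h5 := h1.trans (ENNReal.ofReal_le_ofReal h2)
    rw [ENNReal.ofReal_mul hdk.le] at h5
    exact (ENNReal.mul_le_mul_iff_right (ENNReal.ofReal_pos.2 hdk).ne' ENNReal.ofReal_ne_top).1 h5
  set c : (Fin k → ℤˣ) → Fin d → ℝ := fun ε => ∑ j, ((ε j : ℤ) : ℝ) • Pi.single (f j) 1 with hc
  have hpt : ∀ R : Matrix.orthogonalGroup (Fin d) ℝ, hermitePairing hφ
      (∏ j, linForm ((R : Matrix (Fin d) (Fin d) ℝ) (f j))) ^ 2 ≤
      N ^ 2 * 2 ^ k * ∑ ε, eval ((R : Matrix (Fin d) (Fin d) ℝ)ᵀ *ᵥ c ε) p ^ 2 := by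
    intro R
    rw [prod_linForm_row, map_smul, map_sum, smul_eq_mul, mul_pow, ← hN, mul_assoc]
    refine mul_le_mul_of_nonneg_left ?_ (sq_nonneg _)
    refine sq_sum_le_card_mul_sum_sq.trans ?_
    have hcard : ((Finset.univ : Finset (Fin k → ℤˣ)).card : ℝ) = 2 ^ k := by
      rw [Finset.card_univ, Fintype.card_fun, Fintype.card_fin]; simp
    rw [hcard]
    refine mul_le_mul_of_nonneg_left (Finset.sum_le_sum fun ε _ => ?_) (by positivity)
    rw [map_smul, smul_eq_mul, mul_pow, hpe]
    have : (∏ i, ((ε i : ℤ) : ℝ)) ^ 2 = 1 := by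
      rw [← Finset.prod_pow]
      refine Finset.prod_eq_one fun i _ => ?_
      rcases Int.units_eq_one_or (ε i) with h | h <;> simp [h]
    rw [this, one_mul]
  calc _ ≤ ∫⁻ R, ENNReal.ofReal (N ^ 2 * 2 ^ k) * ∑ ε, ENNReal.ofReal
        (eval ((R : Matrix (Fin d) (Fin d) ℝ)ᵀ *ᵥ c ε) p ^ 2) ∂(haarOrthogonal d) := by
        refine lintegral_mono fun R => ?_
        rw [← ENNReal.ofReal_sum_of_nonneg fun _ _ => sq_nonneg _,
          ← ENNReal.ofReal_mul (by positivity)]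
        exact ENNReal.ofReal_le_ofReal (hpt R)
    _ = ENNReal.ofReal (N ^ 2 * 2 ^ k) * ∑ ε, haarAvg p (c ε) := by
        rw [lintegral_const_mul' _ _ ENNReal.ofReal_ne_top, lintegral_finsetSum]
        · rfl
        · intro ε _
          refine Measurable.ennreal_ofReal (Continuous.measurable ?_)
          exact ((continuous_eval_transpose_mulVec p).comp
            (continuous_id.prodMk continuous_const)).pow 2
    _ ≤ ENNReal.ofReal (N ^ 2 * 2 ^ k) * ∑ _ε : Fin k → ℤˣ,
        ENNReal.ofReal (C₁ * ((d : ℝ) ^ ((k + 1) / 2))⁻¹ * I) := by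
        gcongr with ε
        exact havg _ (dotProduct_self_signed_le f ε)
    _ = _ := by
        rw [← ENNReal.ofReal_sum_of_nonneg fun _ _ => by positivity, Finset.sum_const,
          Finset.card_univ, Fintype.card_fun, Fintype.card_fin,
          ← ENNReal.ofReal_mul (by positivity)]
        congr 1
        simp only [Fintype.card_units_int, nsmul_eq_mul]
        push_cast
        ring

/-- The product of Hermite polynomials along the coordinates `f j`, after a rotation. -/
theorem prod_hermite_mulVec_eq {d : ℕ} {κ : Type*} [Fintype κ] {f : κ → Fin d}
    (hf : Function.Injective f) (R : Matrix.orthogonalGroup (Fin d) ℝ) (α : κ → ℕ)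
    (x : Fin d → ℝ) :
    ∏ j, Polynomial.aeval (((R : Matrix (Fin d) (Fin d) ℝ) *ᵥ x) (f j)) (Polynomial.hermite (α j)) =
      eval x (hermiteMap (∏ j, linForm ((R : Matrix (Fin d) (Fin d) ℝ) (f j)) ^ α j)) := by
  classical
  rw [hermiteMap_prod_linForm_pow]
  · rw [map_prod]
    refine Finset.prod_congr rfl fun j _ => ?_
    rw [eval_polynomial_aeval, eval_linForm]
    rfl
  · intro i j
    have h := congrFun (congrFun (coe_mul_transpose_self R) (f i)) (f j)
    rw [Matrix.one_apply] at h
    simp only [hf.eq_iff] at h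
    exact h

theorem exists_lintegral_sq_integral_prod_hermite_le {κ : Type*} [Fintype κ] (α : κ → ℕ) :
    ∃ C : ℝ, 0 ≤ C ∧ ∀ (d : ℕ) (f : κ → Fin d), Function.Injective f →
      ∀ (φ : (Fin d → ℝ) → ℝ), MemLp φ 2 (gauss (Fin d)) →
      ∫⁻ R, ENNReal.ofReal ((∫ x, φ x * ∏ j, Polynomial.aeval
        (((R : Matrix (Fin d) (Fin d) ℝ) *ᵥ x) (f j)) (Polynomial.hermite (α j))
          ∂(gauss (Fin d))) ^ 2) ∂(haarOrthogonal d) ≤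
      ENNReal.ofReal (C * ((d : ℝ) ^ ((∑ j, α j + 1) / 2))⁻¹ *
        ∫ x, φ x ^ 2 ∂(gauss (Fin d))) := by
  obtain ⟨C, hC, h⟩ := exists_lintegral_sq_hermitePairing_prod_linForm_le (∑ j, α j)
  refine ⟨C, hC, fun d f hf φ hφ => ?_⟩
  -- Row `f j` is listed `α j` times, turning a product of powers into a product of |α| linear
  -- forms.
  let e : (Σ j, Fin (α j)) ≃ Fin (∑ j, α j) := Fintype.equivFinOfCardEq (by simp)
  refine le_of_eq_of_le (lintegral_congr fun R => ?_) (h d (fun i => f (e.symm i).1) φ hφ)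
  congr 2
  rw [hermitePairing_apply]
  refine integral_congr_ae (ae_of_all _ fun x => ?_)
  simp only
  rw [prod_hermite_mulVec_eq hf]
  congr 3
  rw [e.symm.prod_comp (fun s => linForm ((R : Matrix (Fin d) (Fin d) ℝ) (f s.1))),
    Fintype.prod_sigma]
  simp

theorem nat_ceil_half (n : ℕ) : ⌈(n : ℝ) / 2⌉₊ = (n + 1) / 2 := by
  have h : ((n + 1) / 2 : ℕ) * 2 = n ∨ ((n + 1) / 2 : ℕ) * 2 = n + 1 := by omega
  apply le_antisymm
  · rw [Nat.ceil_le]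
    have : (n : ℝ) ≤ ((n + 1) / 2 : ℕ) * 2 := by exact_mod_cast (by omega : n ≤ (n + 1) / 2 * 2)
    linarith
  · have h1 := Nat.le_ceil ((n : ℝ) / 2)
    have h2 : (n : ℝ) ≤ (⌈(n : ℝ) / 2⌉₊ * 2 : ℕ) := by push_cast; linarith
    have h3 : n ≤ ⌈(n : ℝ) / 2⌉₊ * 2 := by exact_mod_cast h2
    omega

theorem exists_lintegral_sq_integral_hermiteProd_le {P : ℕ} (α : Fin P → ℕ) :
    ∃ C : ℝ, 0 < C ∧
      ∀ (d : ℕ) (hPd : P ≤ d) (φ : (Fin d → ℝ) → ℝ),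
        MemLp φ 2 (stdGauss d) → ∫ x, φ x ^ 2 ∂(stdGauss d) = 1 →
          ∫⁻ R, ENNReal.ofReal
              ((∫ x, hermiteProd α ((firstRows hPd R).mulVec x) * φ x ∂(stdGauss d)) ^ 2)
              ∂(haarOrthogonal d) ≤
            ENNReal.ofReal (C * (d : ℝ) ^ (-(⌈((∑ i, α i : ℕ) : ℝ) / 2⌉₊ : ℝ))) := by
  obtain ⟨C, hC, h⟩ := exists_lintegral_sq_integral_prod_hermite_le α
  refine ⟨C + 1, by positivity, fun d hPd φ hφ h1 => ?_⟩
  have h2 := h d (Fin.castLE hPd) (Fin.castLE_injective hPd) φ hφ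
  rw [stdGauss_eq_gauss] at h1
  rw [h1, mul_one] at h2
  refine le_trans (le_of_eq_of_le (lintegral_congr fun R => ?_) h2)
    (ENNReal.ofReal_le_ofReal ?_)
  · rw [stdGauss_eq_gauss]
    congr 2
    exact integral_congr_ae (ae_of_all _ fun x => mul_comm _ _)
  · rw [nat_ceil_half, Real.rpow_neg (Nat.cast_nonneg _), Real.rpow_natCast]
    gcongr
    linarith

end HaarAverage

/-! ### Averages over the stabilizer of a set of rows -/

/-! ### Partial integration of square-integrable functions on a product space -/

section Marginals

variable {X Y : Type*} [MeasurableSpace X] [MeasurableSpace Y] {μ : Measure X} {ν : Measure Y}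
  [IsProbabilityMeasure μ] [IsProbabilityMeasure ν]

theorem memLp_two_mul_prod {Θ : X → ℝ} {Ψ : Y → ℝ} (hΘ : MemLp Θ 2 μ) (hΨ : MemLp Ψ 2 ν) :
    MemLp (fun z : X × Y => Θ z.1 * Ψ z.2) 2 (μ.prod ν) := by
  have hm : AEStronglyMeasurable (fun z : X × Y => Θ z.1 * Ψ z.2) (μ.prod ν) :=
    hΘ.1.comp_fst.mul hΨ.1.comp_snd
  rw [memLp_two_iff_integrable_sq hm]
  simp only [mul_pow]
  exact hΘ.integrable_sq.mul_prod hΨ.integrable_sq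

theorem ae_sq_integral_section_le {φ : X × Y → ℝ} (hφ : MemLp φ 2 (μ.prod ν)) {Ψ : Y → ℝ}
    (hΨ : MemLp Ψ 2 ν) :
    ∀ᵐ x ∂μ, (∫ y, φ (x, y) * Ψ y ∂ν) ^ 2 ≤ (∫ y, φ (x, y) ^ 2 ∂ν) * ∫ y, Ψ y ^ 2 ∂ν := by
  filter_upwards [hφ.1.prodMk_left, hφ.integrable_sq.prod_right_ae] with x h1 h2
  exact sq_integral_mul_le ((memLp_two_iff_integrable_sq h1).2 h2) hΨ

theorem integrable_mul_section {φ : X × Y → ℝ} (hφ : MemLp φ 2 (μ.prod ν)) {Ψ : Y → ℝ}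
    (hΨ : MemLp Ψ 2 ν) {Θ : X → ℝ} (hΘ : MemLp Θ 2 μ) :
    Integrable (fun z : X × Y => φ z * (Θ z.1 * Ψ z.2)) (μ.prod ν) :=
  hφ.integrable_mul (memLp_two_mul_prod hΘ hΨ)

theorem memLp_integral_section {φ : X × Y → ℝ} (hφ : MemLp φ 2 (μ.prod ν)) {Ψ : Y → ℝ}
    (hΨ : MemLp Ψ 2 ν) : MemLp (fun x => ∫ y, φ (x, y) * Ψ y ∂ν) 2 μ := by
  have h1 := (integrable_mul_section hφ hΨ (memLp_const (1 : ℝ))).integral_prod_left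
  simp only [one_mul] at h1
  rw [memLp_two_iff_integrable_sq h1.1]
  refine Integrable.mono' (hφ.integrable_sq.integral_prod_left.mul_const (∫ y, Ψ y ^ 2 ∂ν))
    (h1.1.pow 2) ?_
  filter_upwards [ae_sq_integral_section_le hφ hΨ] with x hx
  rwa [Real.norm_of_nonneg (sq_nonneg _)]

theorem integral_sq_integral_section_le {φ : X × Y → ℝ} (hφ : MemLp φ 2 (μ.prod ν)) {Ψ : Y → ℝ}
    (hΨ : MemLp Ψ 2 ν) :
    ∫ x, (∫ y, φ (x, y) * Ψ y ∂ν) ^ 2 ∂μ ≤ (∫ y, Ψ y ^ 2 ∂ν) * ∫ z, φ z ^ 2 ∂(μ.prod ν) := by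
  rw [integral_prod _ hφ.integrable_sq, mul_comm, ← integral_mul_const]
  exact integral_mono_ae (memLp_integral_section hφ hΨ).integrable_sq
    (hφ.integrable_sq.integral_prod_left.mul_const _) (ae_sq_integral_section_le hφ hΨ)

/-- Integrating out the fixed block against Ψ leaves a function of the moving block alone, to which
the Haar bound applies. -/
theorem integral_mul_section {φ : X × Y → ℝ} (hφ : MemLp φ 2 (μ.prod ν)) {Ψ : Y → ℝ}
    (hΨ : MemLp Ψ 2 ν) {Θ : X → ℝ} (hΘ : MemLp Θ 2 μ) :
    ∫ z, φ z * (Θ z.1 * Ψ z.2) ∂(μ.prod ν) = ∫ x, (∫ y, φ (x, y) * Ψ y ∂ν) * Θ x ∂μ := by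
  rw [integral_prod _ (integrable_mul_section hφ hΨ hΘ)]
  refine integral_congr_ae (ae_of_all _ fun x => ?_)
  simp only
  rw [← integral_mul_const]
  exact integral_congr_ae (ae_of_all _ fun y => by simp only; ring)

end Marginals

/-! ### Orthogonal matrices fixing a block of coordinates -/

section Stabilizer

open scoped Matrix

variable {d d' : ℕ} {A : Type*} [Fintype A] [DecidableEq A]

/-- The orthogonal matrix acting by `V` on the left summand and trivially on the right one. -/
def blockOrthogonal (e : Fin d ≃ Fin d' ⊕ A) (V : Matrix.orthogonalGroup (Fin d') ℝ) :
    Matrix.orthogonalGroup (Fin d) ℝ :=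
  ⟨(Matrix.fromBlocks (V : Matrix (Fin d') (Fin d') ℝ) 0 0 (1 : Matrix A A ℝ)).submatrix e e, by
    rw [Matrix.mem_orthogonalGroup_iff]
    rw [Matrix.transpose_submatrix, Matrix.submatrix_mul_equiv, Matrix.fromBlocks_transpose,
      Matrix.fromBlocks_multiply]
    simp [coe_mul_transpose_self]⟩

theorem continuous_blockOrthogonal (e : Fin d ≃ Fin d' ⊕ A) :
    Continuous (blockOrthogonal e) := by
  refine Continuous.subtype_mk ?_ _
  exact (Continuous.matrix_fromBlocks continuous_subtype_val continuous_const continuous_const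
    continuous_const).matrix_submatrix _ _

theorem blockOrthogonal_mulVec_inl (e : Fin d ≃ Fin d' ⊕ A)
    (V : Matrix.orthogonalGroup (Fin d') ℝ) (x : Fin d → ℝ) (j : Fin d') :
    ((blockOrthogonal e V : Matrix (Fin d) (Fin d) ℝ) *ᵥ x) (e.symm (Sum.inl j)) =
      ((V : Matrix (Fin d') (Fin d') ℝ) *ᵥ fun k => x (e.symm (Sum.inl k))) j := by
  simp only [blockOrthogonal, Matrix.mulVec, dotProduct, Matrix.submatrix_apply]
  rw [← e.symm.sum_comp, Fintype.sum_sum_type]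
  simp

theorem blockOrthogonal_mulVec_inr (e : Fin d ≃ Fin d' ⊕ A)
    (V : Matrix.orthogonalGroup (Fin d') ℝ) (x : Fin d → ℝ) (a : A) :
    ((blockOrthogonal e V : Matrix (Fin d) (Fin d) ℝ) *ᵥ x) (e.symm (Sum.inr a)) =
      x (e.symm (Sum.inr a)) := by
  simp only [blockOrthogonal, Matrix.mulVec, dotProduct, Matrix.submatrix_apply]
  rw [← e.symm.sum_comp, Fintype.sum_sum_type]
  simp [Matrix.one_apply]

/-- Joining the two blocks of coordinates. -/
def joinCoords (e : Fin d ≃ Fin d' ⊕ A) (z : (Fin d' → ℝ) × (A → ℝ)) : Fin d → ℝ :=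
  fun i => Sum.elim z.1 z.2 (e i)

theorem measurePreserving_joinCoords (e : Fin d ≃ Fin d' ⊕ A) :
    MeasurePreserving (joinCoords e) ((gauss (Fin d')).prod (gauss A)) (gauss (Fin d)) := by
  have h1 := measurePreserving_sumPiEquivProdPi_symm
    (fun _ : Fin d' ⊕ A => gaussianReal 0 1)
  have h2 := measurePreserving_piCongrLeft (fun _ : Fin d => gaussianReal 0 1) e.symm
  have h3 := h2.comp h1
  have heq : joinCoords e = (MeasurableEquiv.piCongrLeft (fun _ => ℝ) e.symm) ∘
      (MeasurableEquiv.sumPiEquivProdPi fun _ => ℝ).symm := by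
    ext z i
    obtain ⟨s, rfl⟩ := e.symm.surjective i
    rw [Function.comp_apply, MeasurableEquiv.coe_piCongrLeft, Equiv.piCongrLeft_apply_apply]
    rcases s with j | a
    · simp only [joinCoords, Equiv.apply_symm_apply]; rfl
    · simp only [joinCoords, Equiv.apply_symm_apply]; rfl
  rw [heq]
  exact h3

/-- The product of Hermite polynomials over all coordinates. -/
noncomputable def hermiteProdAll {κ : Type*} [Fintype κ] (α : κ → ℕ) (y : κ → ℝ) : ℝ :=
  ∏ j, Polynomial.aeval (y j) (Polynomial.hermite (α j))

theorem memLp_hermiteProdAll_comp {κ ι : Type*} [Fintype κ] [Fintype ι] (f : κ → ι) (α : κ → ℕ) :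
    MemLp (fun x : ι → ℝ => hermiteProdAll α fun j => x (f j)) 2 (gauss ι) := by
  have h := memLp_eval_gauss (∏ j, Polynomial.aeval (MvPolynomial.X (f j) : MvPolynomial ι ℝ)
    (Polynomial.hermite (α j)))
  convert h using 1
  ext x
  rw [map_prod, hermiteProdAll]
  refine Finset.prod_congr rfl fun j _ => ?_
  rw [eval_polynomial_aeval, MvPolynomial.eval_X]

theorem memLp_hermiteProdAll {κ : Type*} [Fintype κ] (α : κ → ℕ) :
    MemLp (hermiteProdAll α) 2 (gauss κ) := memLp_hermiteProdAll_comp id α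

theorem memLp_comp_mulVec {φ : (Fin d → ℝ) → ℝ} (hφ : MemLp φ 2 (gauss (Fin d)))
    (R : Matrix.orthogonalGroup (Fin d) ℝ) :
    MemLp (fun x => φ ((R : Matrix (Fin d) (Fin d) ℝ) *ᵥ x)) 2 (gauss (Fin d)) :=
  hφ.comp_measurePreserving (measurePreserving_mulVec_gauss (coe_mul_transpose_self R))

theorem measurableEmbedding_mulVec (R : Matrix.orthogonalGroup (Fin d) ℝ) :
    MeasurableEmbedding fun x : Fin d → ℝ => (R : Matrix (Fin d) (Fin d) ℝ) *ᵥ x := by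
  refine Continuous.measurableEmbedding (by fun_prop) fun x y h => ?_
  have := congrArg (fun z => (R : Matrix (Fin d) (Fin d) ℝ)ᵀ *ᵥ z) h
  simpa [Matrix.mulVec_mulVec, transpose_mul_coe_self] using this

theorem integral_comp_mulVec_gauss (R : Matrix.orthogonalGroup (Fin d) ℝ) (F : (Fin d → ℝ) → ℝ) :
    ∫ x, F ((R : Matrix (Fin d) (Fin d) ℝ) *ᵥ x) ∂(gauss (Fin d)) = ∫ x, F x ∂(gauss (Fin d)) :=
  (measurePreserving_mulVec_gauss (coe_mul_transpose_self R)).integral_comp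
    (measurableEmbedding_mulVec R) F

theorem measurableEmbedding_joinCoords (e : Fin d ≃ Fin d' ⊕ A) :
    MeasurableEmbedding (joinCoords e) := by
  have hc : Continuous (joinCoords e) := by
    refine continuous_pi fun i => ?_
    unfold joinCoords
    rcases e i with j | a
    · exact (continuous_apply j).comp continuous_fst
    · exact (continuous_apply a).comp continuous_snd
  refine hc.measurableEmbedding fun z w h => ?_
  refine Prod.ext (funext fun j => ?_) (funext fun a => ?_)
  · simpa [joinCoords] using congrFun h (e.symm (Sum.inl j))
  · simpa [joinCoords] using congrFun h (e.symm (Sum.inr a))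

/-- `φ(Rᵀ y)` in the two blocks of coordinates. -/
def blockPullback (e : Fin d ≃ Fin d' ⊕ A) (R : Matrix.orthogonalGroup (Fin d) ℝ)
    (φ : (Fin d → ℝ) → ℝ) (z : (Fin d' → ℝ) × (A → ℝ)) : ℝ :=
  φ ((R⁻¹ : Matrix.orthogonalGroup (Fin d) ℝ).1 *ᵥ joinCoords e z)

theorem memLp_blockPullback (e : Fin d ≃ Fin d' ⊕ A) (R : Matrix.orthogonalGroup (Fin d) ℝ)
    {φ : (Fin d → ℝ) → ℝ} (hφ : MemLp φ 2 (gauss (Fin d))) :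
    MemLp (blockPullback e R φ) 2 ((gauss (Fin d')).prod (gauss A)) :=
  (memLp_comp_mulVec hφ R⁻¹).comp_measurePreserving (measurePreserving_joinCoords e)

theorem integral_blockPullback (e : Fin d ≃ Fin d' ⊕ A) (R : Matrix.orthogonalGroup (Fin d) ℝ)
    (φ : (Fin d → ℝ) → ℝ) :
    ∫ z, blockPullback e R φ z ∂((gauss (Fin d')).prod (gauss A)) = ∫ x, φ x ∂(gauss (Fin d)) := by
  rw [← integral_comp_mulVec_gauss R⁻¹ φ]
  exact (measurePreserving_joinCoords e).integral_comp (measurableEmbedding_joinCoords e)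
    (fun y => φ ((R⁻¹ : Matrix.orthogonalGroup (Fin d) ℝ).1 *ᵥ y))

/-- After the substitution x = R⁻¹y only V ⊕ 1 acts: factors outside J see V, factors in J see plain
coordinates, and the Hermite product splits. -/
theorem blockPullback_hermiteProd {P : ℕ} (S : Fin P → ℕ) (J : Finset (Fin P)) (g : Fin P → Fin d)
    (e : Fin d ≃ Fin d' ⊕ {j // j ∈ J}) (f : {j // j ∉ J} → Fin d')
    (hg₁ : ∀ j, g j.1 = e.symm (Sum.inl (f j))) (hg₂ : ∀ j, g j.1 = e.symm (Sum.inr j))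
    (φ : (Fin d → ℝ) → ℝ) (R : Matrix.orthogonalGroup (Fin d) ℝ)
    (V : Matrix.orthogonalGroup (Fin d') ℝ) (z : (Fin d' → ℝ) × ({j // j ∈ J} → ℝ)) :
    blockPullback e R (fun x => φ x * hermiteProd S (fun j =>
      ((blockOrthogonal e V * R : Matrix.orthogonalGroup (Fin d) ℝ).1 *ᵥ x) (g j))) z =
    blockPullback e R φ z * ((hermiteProdAll (fun j : {j // j ∉ J} => S j)
      fun j => (V.1 *ᵥ z.1) (f j)) * hermiteProdAll (fun j : {j // j ∈ J} => S j) z.2) := by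
  have h1 : (blockOrthogonal e V * R : Matrix.orthogonalGroup (Fin d) ℝ).1 *ᵥ
      ((R⁻¹ : Matrix.orthogonalGroup (Fin d) ℝ).1 *ᵥ joinCoords e z) =
      (blockOrthogonal e V).1 *ᵥ joinCoords e z := by
    have h2 : (blockOrthogonal e V * R : Matrix.orthogonalGroup (Fin d) ℝ).1 *
        (R⁻¹ : Matrix.orthogonalGroup (Fin d) ℝ).1 = (blockOrthogonal e V).1 := by
      rw [← Submonoid.coe_mul, mul_inv_cancel_right]
    rw [Matrix.mulVec_mulVec, h2]
  simp only [blockPullback]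
  rw [h1]
  congr 1
  rw [hermiteProd, hermiteProdAll, hermiteProdAll,
    ← Fintype.prod_subtype_mul_prod_subtype (fun j => j ∈ J), mul_comm]
  congr 1
  · refine Finset.prod_congr (by ext; simp) fun j _ => ?_
    rw [hg₁, blockOrthogonal_mulVec_inl]
    simp [joinCoords]
  · refine Finset.prod_congr (by ext; simp) fun j _ => ?_
    rw [hg₂, blockOrthogonal_mulVec_inr]
    simp [joinCoords]

/-- Averaging over the block-orthogonal matrices: only the rows moved by the block gain. -/
theorem exists_lintegral_blockOrthogonal_le {P : ℕ} (S : Fin P → ℕ) (J : Finset (Fin P)) :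
    ∃ C : ℝ, 0 ≤ C ∧ ∀ (d d' : ℕ) (g : Fin P → Fin d) (e : Fin d ≃ Fin d' ⊕ {j // j ∈ J})
      (f : {j // j ∉ J} → Fin d'), Function.Injective f → (∀ j, g j.1 = e.symm (Sum.inl (f j))) →
      (∀ j, g j.1 = e.symm (Sum.inr j)) →
      ∀ (φ : (Fin d → ℝ) → ℝ), MemLp φ 2 (gauss (Fin d)) → ∀ R : Matrix.orthogonalGroup (Fin d) ℝ,
      ∫⁻ V, ENNReal.ofReal ((∫ x, φ x * hermiteProd S
        (fun j => ((blockOrthogonal e V * R : Matrix.orthogonalGroup (Fin d) ℝ).1 *ᵥ x) (g j))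
          ∂(gauss (Fin d))) ^ 2) ∂(haarOrthogonal d') ≤
      ENNReal.ofReal (C * ((d' : ℝ) ^ ((∑ j : {j // j ∉ J}, S j + 1) / 2))⁻¹ *
        ∫ x, φ x ^ 2 ∂(gauss (Fin d))) := by
  obtain ⟨C, hC, h⟩ := exists_lintegral_sq_integral_prod_hermite_le
    (fun j : {j // j ∉ J} => S j)
  have hΨ : MemLp (hermiteProdAll fun j : {j // j ∈ J} => S j) 2 (gauss {j // j ∈ J}) :=
    memLp_hermiteProdAll _
  set I := ∫ y, hermiteProdAll (fun j : {j // j ∈ J} => S j) y ^ 2 ∂(gauss {j // j ∈ J}) with hI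
  have hI0 : 0 ≤ I := integral_nonneg fun y => sq_nonneg _
  refine ⟨C * I, by positivity, fun d d' g e f hf hg₁ hg₂ φ hφ R => ?_⟩
  have hφ₂ := memLp_blockPullback e R hφ
  have hn : ∫ z, blockPullback e R φ z ^ 2 ∂((gauss (Fin d')).prod (gauss _)) =
      ∫ x, φ x ^ 2 ∂(gauss (Fin d)) := integral_blockPullback e R fun x => φ x ^ 2
  refine (le_of_eq_of_le (lintegral_congr fun V => ?_)
    (h d' f hf _ (memLp_integral_section hφ₂ hΨ))).trans (ENNReal.ofReal_le_ofReal ?_)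
  · congr 2
    have hΘ : MemLp (fun x : Fin d' → ℝ => hermiteProdAll (fun j : {j // j ∉ J} => S j)
        fun j => (V.1 *ᵥ x) (f j)) 2 (gauss (Fin d')) :=
      memLp_comp_mulVec (memLp_hermiteProdAll_comp f fun j : {j // j ∉ J} => S j) V
    have h3 := integral_mul_section hφ₂ hΨ hΘ
    rw [← integral_blockPullback e R]
    simp only [blockPullback_hermiteProd S J g e f hg₁ hg₂ φ R V]
    exact h3
  · have h3 := integral_sq_integral_section_le hφ₂ hΨ
    rw [hn, ← hI] at h3
    calc _ ≤ C * ((d' : ℝ) ^ ((∑ j : {j // j ∉ J}, S j + 1) / 2))⁻¹ *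
          (I * ∫ x, φ x ^ 2 ∂(gauss (Fin d))) := mul_le_mul_of_nonneg_left h3 (by positivity)
      _ = _ := by ring

end Stabilizer

/-! ### Second moments on events determined by the rows in `J` -/

section ConditionalBound

open scoped Matrix

instance orthogonalGroup_secondCountableTopology (d : ℕ) :
    SecondCountableTopology (Matrix.orthogonalGroup (Fin d) ℝ) := by
  have : SecondCountableTopology (Matrix (Fin d) (Fin d) ℝ) :=
    inferInstanceAs (SecondCountableTopology (Fin d → Fin d → ℝ))
  exact TopologicalSpace.Subtype.secondCountableTopology _

theorem exists_block_equiv {P d : ℕ} (hPd : P ≤ d) (J : Finset (Fin P)) :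
    ∃ (d' : ℕ) (e : Fin d ≃ Fin d' ⊕ {j // j ∈ J}) (f : {j // j ∉ J} → Fin d'),
      Function.Injective f ∧ (∀ j, Fin.castLE hPd j.1 = e.symm (Sum.inl (f j))) ∧
      (∀ j, Fin.castLE hPd j.1 = e.symm (Sum.inr j)) := by
  classical
  set ι : {j // j ∈ J} → Fin d := fun j => Fin.castLE hPd j.1 with hι
  have hinj : Function.Injective ι := fun a b h => Subtype.ext (Fin.castLE_injective hPd h)
  let e₁ : {i // i ∈ Set.range ι} ≃ {j // j ∈ J} := (Equiv.ofInjective ι hinj).symm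
  let e₂ : {i // ¬ i ∈ Set.range ι} ≃ Fin (Fintype.card {i // ¬ i ∈ Set.range ι}) :=
    Fintype.equivFin _
  have hnot : ∀ j : {j // j ∉ J}, ¬ Fin.castLE hPd j.1 ∈ Set.range ι := by
    rintro j ⟨k, hk⟩
    have : k.1 = j.1 := Fin.castLE_injective hPd hk
    exact j.2 (this ▸ k.2)
  refine ⟨_, (Equiv.sumCompl fun i => i ∈ Set.range ι).symm.trans
    ((Equiv.sumComm _ _).trans (Equiv.sumCongr e₂ e₁)),
    fun j => e₂ ⟨Fin.castLE hPd j.1, hnot j⟩, ?_, ?_, ?_⟩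
  · intro a b h
    have := Subtype.mk.inj (e₂.injective h)
    exact Subtype.ext (Fin.castLE_injective hPd this)
  · intro j
    simp
  · intro j
    simp [e₁, hι]

/-- Removing at most P coordinates costs a constant: d ≤ d' + P ≤ (P + 1) d' because d' ≥ 1. -/
theorem inv_pow_le_rpow {P d d' s ℓ : ℕ} (hd' : 1 ≤ d') (hd : 1 ≤ d) (hdd : d ≤ d' + P)
    (hs : ℓ ≤ s) :
    ((d' : ℝ) ^ ((s + 1) / 2))⁻¹ ≤
      ((P : ℝ) + 1) ^ ((s + 1) / 2) * (d : ℝ) ^ (-(ℓ : ℝ) / 2) := by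
  have h1 : (d : ℝ) ≤ (P + 1) * d' := by
    have h : d ≤ (P + 1) * d' := by nlinarith
    exact_mod_cast h
  have hd0 : (1 : ℝ) ≤ d := by exact_mod_cast hd
  have hd0' : (1 : ℝ) ≤ d' := by exact_mod_cast hd'
  have h2 : (d : ℝ) ^ (ℓ / 2 : ℝ) ≤ ((P : ℝ) + 1) ^ ((s + 1) / 2) * (d' : ℝ) ^ ((s + 1) / 2) := by
    calc (d : ℝ) ^ (ℓ / 2 : ℝ) ≤ (d : ℝ) ^ (((s + 1) / 2 : ℕ) : ℝ) := by
          apply Real.rpow_le_rpow_of_exponent_le hd0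
          have : ℓ ≤ (s + 1) / 2 * 2 := by omega
          have : (ℓ : ℝ) ≤ ((s + 1) / 2 : ℕ) * 2 := by exact_mod_cast this
          linarith
      _ = (d : ℝ) ^ ((s + 1) / 2) := Real.rpow_natCast _ _
      _ ≤ _ := by rw [← mul_pow]; gcongr
  rw [neg_div, Real.rpow_neg (by positivity), ← div_eq_mul_inv, inv_eq_one_div,
    div_le_div_iff₀ (by positivity) (by positivity), one_mul]
  exact h2

theorem continuous_hermiteProd {P : ℕ} (S : Fin P → ℕ) : Continuous (hermiteProd S) := by
  unfold hermiteProd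
  refine continuous_finsetProd _ fun i _ => ?_
  exact (Polynomial.continuous_aeval _).comp (continuous_apply i)

theorem measurable_integral_mul_comp_mulVec {P d : ℕ} {φ : (Fin d → ℝ) → ℝ} (hφ : Measurable φ)
    {F : (Fin P → ℝ) → ℝ} (hF : Continuous F) :
    Measurable fun N : Matrix (Fin P) (Fin d) ℝ => ∫ x, φ x * F (N *ᵥ x) ∂(gauss (Fin d)) := by
  refine StronglyMeasurable.measurable (StronglyMeasurable.integral_prod_right
    (f := fun (N : Matrix (Fin P) (Fin d) ℝ) x => φ x * F (N *ᵥ x)) ?_)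
  refine Measurable.stronglyMeasurable ((hφ.comp measurable_snd).mul (Continuous.measurable ?_))
  exact hF.comp (by fun_prop)

/-- Conditioning on the rows in J without disintegration: left multiplication by V ⊕ 1 preserves
both Haar measure and G, so the integral over G may be averaged over V first. -/
theorem exists_setLIntegral_sq_integral_hermiteProd_le {P : ℕ} (S : Fin P → ℕ)
    (J : Finset (Fin P)) {ℓ : ℕ} (hℓ : 1 ≤ ℓ) (hs : ℓ ≤ ∑ j : {j // j ∉ J}, S j) :
    ∃ C : ℝ, 0 ≤ C ∧ ∀ (d : ℕ) (hPd : P ≤ d) (G : Set (Matrix.orthogonalGroup (Fin d) ℝ)),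
      MeasurableSet G →
      (∀ R R' : Matrix.orthogonalGroup (Fin d) ℝ, (∀ j ∈ J, firstRows hPd R j = firstRows hPd R' j)
        → (R ∈ G ↔ R' ∈ G)) →
      ∀ φ : (Fin d → ℝ) → ℝ, Measurable φ → MemLp φ 2 (gauss (Fin d)) →
      ∫⁻ R in G, ENNReal.ofReal ((∫ x, φ x * hermiteProd S (firstRows hPd R *ᵥ x)
        ∂(gauss (Fin d))) ^ 2) ∂(haarOrthogonal d) ≤
      ENNReal.ofReal (C * (d : ℝ) ^ (-(ℓ : ℝ) / 2) * ∫ x, φ x ^ 2 ∂(gauss (Fin d))) *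
        haarOrthogonal d G := by
  obtain ⟨C, hC, h⟩ := exists_lintegral_blockOrthogonal_le S J
  set s := ∑ j : {j // j ∉ J}, S j with hsdef
  refine ⟨C * ((P : ℝ) + 1) ^ ((s + 1) / 2), by positivity, fun d hPd G hG hGJ φ hφm hφ => ?_⟩
  obtain ⟨d', e, f, hf, hg₁, hg₂⟩ := exists_block_equiv hPd J
  -- Since ℓ ≥ 1, some row lies outside J; this makes the moving block nonempty.
  have hne : Nonempty {j // j ∉ J} := by
    by_contra hemp
    rw [not_nonempty_iff] at hemp
    simp [hsdef] at hs
    omega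
  have hd' : 1 ≤ d' := by
    have := (f hne.some).2
    omega
  have hdcard : d = d' + J.card := by
    have := Fintype.card_congr e
    simpa using this
  have hJ : J.card ≤ P := by simpa using Finset.card_le_univ J
  have hI0 : 0 ≤ ∫ x, φ x ^ 2 ∂(gauss (Fin d)) := integral_nonneg fun x => sq_nonneg _
  set F : Matrix.orthogonalGroup (Fin d) ℝ → ENNReal := fun R =>
    ENNReal.ofReal ((∫ x, φ x * hermiteProd S (firstRows hPd R *ᵥ x) ∂(gauss (Fin d))) ^ 2) with hF
  have hFm : Measurable F := 
    (((measurable_integral_mul_comp_mulVec hφm (continuous_hermiteProd S)).comp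
      (measurable_firstRows hPd)).pow_const 2).ennreal_ofReal
  have hrow : ∀ V R, ∀ j ∈ J, firstRows hPd R j = firstRows hPd (blockOrthogonal e V * R) j := by
    intro V R j hj
    ext k
    have h1 := blockOrthogonal_mulVec_inr e V (fun l => R.1 l k) ⟨j, hj⟩
    rw [← hg₂ ⟨j, hj⟩] at h1
    exact h1.symm
  set B := ENNReal.ofReal (C * ((P : ℝ) + 1) ^ ((s + 1) / 2) * (d : ℝ) ^ (-(ℓ : ℝ) / 2) *
    ∫ x, φ x ^ 2 ∂(gauss (Fin d))) with hB
  have hin : ∀ R, ∫⁻ V, F (blockOrthogonal e V * R) ∂(haarOrthogonal d') ≤ B := by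
    intro R
    refine (h d d' (Fin.castLE hPd) e f hf hg₁ hg₂ φ hφ R).trans (ENNReal.ofReal_le_ofReal ?_)
    refine mul_le_mul_of_nonneg_right ?_ hI0
    rw [mul_assoc]
    exact mul_le_mul_of_nonneg_left (inv_pow_le_rpow hd' (by omega) (by omega) hs) hC
  have hcont : Continuous fun z : Matrix.orthogonalGroup (Fin d') ℝ ×
      Matrix.orthogonalGroup (Fin d) ℝ => blockOrthogonal e z.1 * z.2 :=
    ((continuous_blockOrthogonal e).comp continuous_fst).mul continuous_snd
  have hV : ∀ V, ∫⁻ R in G, F R ∂(haarOrthogonal d) =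
      ∫⁻ R in G, F (blockOrthogonal e V * R) ∂(haarOrthogonal d) := by
    intro V
    rw [← lintegral_indicator hG, ← lintegral_indicator hG,
      ← lintegral_mul_left_eq_self _ (blockOrthogonal e V)]
    refine lintegral_congr fun R => ?_
    have := hGJ R (blockOrthogonal e V * R) (hrow V R)
    by_cases hR : R ∈ G
    · rw [Set.indicator_of_mem hR, Set.indicator_of_mem (this.1 hR)]
    · rw [Set.indicator_of_notMem hR, Set.indicator_of_notMem (fun h => hR (this.2 h))]
  calc ∫⁻ R in G, F R ∂(haarOrthogonal d)
      = ∫⁻ _V, ∫⁻ R in G, F R ∂(haarOrthogonal d) ∂(haarOrthogonal d') := by simp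
    _ = ∫⁻ V, ∫⁻ R in G, F (blockOrthogonal e V * R) ∂(haarOrthogonal d) ∂(haarOrthogonal d') :=
        lintegral_congr hV
    _ = ∫⁻ R in G, ∫⁻ V, F (blockOrthogonal e V * R) ∂(haarOrthogonal d') ∂(haarOrthogonal d) :=
        lintegral_lintegral_swap (hFm.comp hcont.measurable).aemeasurable
    _ ≤ ∫⁻ _R in G, B ∂(haarOrthogonal d) := lintegral_mono fun R => hin R
    _ = B * haarOrthogonal d G := by simp

end ConditionalBound

/-! ### Coordinates that a small leap cannot reach -/

section Leap

theorem leapIncrement_snoc_castSucc {P m : ℕ} (π : Fin m → Fin P → ℕ) (S : Fin P → ℕ)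
    (i : Fin m) :
    leapIncrement (Fin.snoc π S : Fin (m + 1) → Fin P → ℕ) i.castSucc = leapIncrement π i := by
  unfold leapIncrement
  refine Finset.sum_congr rfl fun k _ => ?_
  have h : (∀ j < i.castSucc, (Fin.snoc π S : Fin (m + 1) → Fin P → ℕ) j k = 0) ↔
      ∀ j < i, π j k = 0 := by
    constructor
    · intro h j hj
      simpa using h j.castSucc (Fin.castSucc_lt_castSucc_iff.2 hj)
    · intro h j hj
      obtain ⟨j, rfl⟩ := Fin.exists_castSucc_eq.2 (ne_of_lt (hj.trans (Fin.castSucc_lt_last i)))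
      simpa using h j (Fin.castSucc_lt_castSucc_iff.1 hj)
  simp only [h, Fin.snoc_castSucc]

theorem leapIncrement_snoc_last {P m : ℕ} (π : Fin m → Fin P → ℕ) (S : Fin P → ℕ) :
    leapIncrement (Fin.snoc π S : Fin (m + 1) → Fin P → ℕ) (Fin.last m) =
      ∑ k, if ∀ j, π j k = 0 then S k else 0 := by
  unfold leapIncrement
  refine Finset.sum_congr rfl fun k _ => ?_
  have h : (∀ j < Fin.last m, (Fin.snoc π S : Fin (m + 1) → Fin P → ℕ) j k = 0) ↔
      ∀ j, π j k = 0 := by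
    constructor
    · intro h j
      simpa using h j.castSucc (Fin.castSucc_lt_last j)
    · intro h j hj
      obtain ⟨j, rfl⟩ := Fin.exists_castSucc_eq.2 (ne_of_lt hj)
      simpa using h j
  simp only [h, Fin.snoc_last]

/-- Take a longest injective sequence in 𝒮 with all increments below the leap, and let J be the
coordinates it touches. A multi-index outside the sequence with small degree off J could be
appended. If no multi-index had large degree off J, the sequence would exhaust 𝒮 and beat the
minimum. -/
theorem exists_coords_of_leapOf {P : ℕ} {𝒮 : Set (Fin P → ℕ)} (h : 1 ≤ leapOf 𝒮) :
    ∃ J : Finset (Fin P),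
      (∀ S ∈ 𝒮, (∀ k ∉ J, S k = 0) ∨ leapOf 𝒮 ≤ ∑ k : {k // k ∉ J}, S k) ∧
      ∃ S ∈ 𝒮, leapOf 𝒮 ≤ ∑ k : {k // k ∉ J}, S k := by
  classical
  -- `sInf ∅ = 0` in ℕ, so a positive leap means that an enumeration exists.
  have hfin : 𝒮.Finite := by
    have hne : {l | ∃ (m : ℕ) (π : Fin m → Fin P → ℕ), Function.Injective π ∧ Set.range π = 𝒮 ∧
        l = Finset.univ.sup (leapIncrement π)}.Nonempty :=
      Nat.nonempty_of_pos_sInf h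
    obtain ⟨_, m, π, _, hπ, _⟩ := hne
    rw [← hπ]
    exact Set.finite_range π
  set T : ℕ → Prop := fun m => ∃ π : Fin m → Fin P → ℕ, Function.Injective π ∧
    Set.range π ⊆ 𝒮 ∧ ∀ i, leapIncrement π i < leapOf 𝒮 with hT
  have hT0 : T 0 := ⟨Fin.elim0, fun i => i.elim0, by rintro _ ⟨i, _⟩; exact i.elim0,
    fun i => i.elim0⟩
  have hTle : ∀ m, T m → m ≤ 𝒮.ncard := by
    rintro m ⟨π, hπ, hsub, _⟩
    have h1 := Set.ncard_le_ncard hsub hfin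
    rwa [← Set.image_univ, Set.ncard_image_of_injective _ hπ, Set.ncard_univ, Nat.card_fin] at h1
  have hspec := Nat.findGreatest_spec (P := T) (Nat.zero_le 𝒮.ncard) hT0
  set m := Nat.findGreatest T 𝒮.ncard with hm
  obtain ⟨π, hπ, hsub, hinc⟩ := hspec
  have hmax : ¬ T (m + 1) := fun h1 => by
    have := Nat.le_findGreatest (hTle _ h1) h1
    omega
  set J : Finset (Fin P) := Finset.univ.filter fun k => ∃ j, π j k ≠ 0 with hJ
  have hsum : ∀ S : Fin P → ℕ, (∑ k, if ∀ j, π j k = 0 then S k else 0) =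
      ∑ k : {k // k ∉ J}, S k := by
    intro S
    rw [← Finset.sum_filter]
    refine (Finset.sum_subtype _ (fun k => ?_) S)
    simp [hJ]
  have hout : ∀ S ∈ 𝒮, S ∉ Set.range π → leapOf 𝒮 ≤ ∑ k : {k // k ∉ J}, S k := by
    intro S hS hSπ
    by_contra hlt
    push Not at hlt
    refine hmax ⟨Fin.snoc π S, Fin.snoc_injective_iff.2 ⟨hπ, hSπ⟩, ?_, ?_⟩
    · rw [Fin.range_snoc]
      exact Set.insert_subset hS hsub
    · intro i
      refine Fin.lastCases ?_ (fun i => ?_) i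
      · rw [leapIncrement_snoc_last, hsum]; exact hlt
      · rw [leapIncrement_snoc_castSucc]; exact hinc i
  refine ⟨J, fun S hS => ?_, ?_⟩
  · by_cases hSπ : S ∈ Set.range π
    · left
      obtain ⟨j, rfl⟩ := hSπ
      intro k hk
      by_contra h0
      exact hk (by simp only [hJ, Finset.mem_filter, Finset.mem_univ, true_and]; exact ⟨j, h0⟩)
    · exact Or.inr (hout S hS hSπ)
  · by_contra hno
    push Not at hno
    have hrange : Set.range π = 𝒮 := by
      refine hsub.antisymm fun S hS => ?_
      by_contra hSπ
      exact absurd (hout S hS hSπ) (not_le.2 (hno S hS))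
    have h1 : leapOf 𝒮 ≤ Finset.univ.sup (leapIncrement π) :=
      Nat.sInf_le ⟨m, π, hπ, hrange, rfl⟩
    -- Positivity of the leap covers the empty sequence, whose supremum is 0.
    have h2 : Finset.univ.sup (leapIncrement π) < leapOf 𝒮 :=
      (Finset.sup_lt_iff (by rw [bot_eq_zero']; omega)).2 fun i _ => hinc i
    omega

end Leap

/-! ### The Hermite expansion of a polynomial -/

section Expansion

open MvPolynomial

open scoped Matrix

theorem eval_hermiteMv {P : ℕ} (S : Fin P → ℕ) (x : Fin P → ℝ) :
    eval x (hermiteMv S) = hermiteProd S x := by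
  rw [hermiteMv, hermiteProd, map_prod]
  exact Finset.prod_congr rfl fun i _ => by rw [eval_polynomial_aeval, eval_X]

theorem integral_hermiteProd_mul {P : ℕ} (S T : Fin P → ℕ) :
    ∫ y, hermiteProd S y * hermiteProd T y ∂(gauss (Fin P)) =
      gaussExp (Fin P) (hermiteMv S * hermiteMv T) := by
  rw [gaussExp_apply]
  simp only [map_mul, eval_hermiteMv]

/-- In the rotated variables h becomes q(y) = h(Qᵀy). Surjectivity of `hermiteMap` expands q in
Hermite products, and orthogonality identifies the coefficients. -/
theorem exists_hermite_expansion {P : ℕ} (h : MvPolynomial (Fin P) ℝ)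
    (Q : Matrix.orthogonalGroup (Fin P) ℝ) :
    ∃ s : Finset (Fin P → ℕ), (∀ S, S ∈ s ↔ hermiteCoeff h Q S ≠ 0) ∧
      ∀ z, eval z h = ∑ S ∈ s, hermiteCoeff h Q S * hermiteProd S (Q.1 *ᵥ z) := by
  set q : MvPolynomial (Fin P) ℝ := bind₁ (fun i => linForm (Q.1ᵀ i)) h with hq
  have hqe : ∀ y, eval y q = eval (Q.1ᵀ *ᵥ y) h := by
    intro y
    have := MvPolynomial.aeval_bind₁ (R := ℝ) y (fun i => linForm (Q.1ᵀ i)) h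
    simp only [MvPolynomial.aeval_eq_eval, eval_linForm] at this
    exact this
  obtain ⟨p, hp⟩ := hermiteMap_surjective q
  have hpq : q = ∑ β ∈ p.support, coeff β p • hermiteMv (β : Fin P → ℕ) := by
    conv_lhs => rw [← hp, p.as_sum, map_sum]
    exact Finset.sum_congr rfl fun β _ => hermiteMap_monomial β _
  have hcoeff : ∀ β : Fin P →₀ ℕ, hermiteCoeff h Q β = coeff β p := by
    intro β
    have h1 : ∫ z, eval z h * hermiteProd (β : Fin P → ℕ) (Q.1 *ᵥ z) ∂(gauss (Fin P)) =
        gaussExp (Fin P) (q * hermiteMv (β : Fin P → ℕ)) := by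
      rw [gaussExp_apply, ← integral_comp_mulVec_gauss Q
        fun y => eval y (q * hermiteMv (β : Fin P → ℕ))]
      refine integral_congr_ae (ae_of_all _ fun z => ?_)
      simp only [map_mul, hqe, eval_hermiteMv, Matrix.mulVec_mulVec, transpose_mul_coe_self,
        Matrix.one_mulVec]
    rw [hermiteCoeff, stdGauss_eq_gauss, h1, hpq, Finset.sum_mul, map_sum, Finset.sum_eq_single β]
    · rw [smul_mul_assoc, map_smul, gaussExp_hermiteMv_self, smul_eq_mul, mul_div_assoc,
        div_self (Finset.prod_ne_zero_iff.2 fun i _ => by positivity), mul_one]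
    · intro γ _ hγ
      rw [smul_mul_assoc, map_smul, gaussExp_hermiteMv_of_ne (fun h => hγ (DFunLike.coe_injective h)),
        smul_zero]
    · intro hβ
      rw [notMem_support_iff.1 hβ, zero_smul, zero_mul, map_zero]
  refine ⟨p.support.map ⟨fun β : Fin P →₀ ℕ => (⇑β : Fin P → ℕ), DFunLike.coe_injective⟩,
    fun S => ?_, fun z => ?_⟩
  · have h2 := hcoeff (Finsupp.equivFunOnFinite.symm S)
    rw [Finsupp.coe_equivFunOnFinite_symm] at h2
    rw [h2, ← mem_support_iff, Finset.mem_map]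
    constructor
    · rintro ⟨β, hβ, rfl⟩
      simpa using hβ
    · intro hS
      exact ⟨_, hS, by simp⟩
  · have h3 := hqe (Q.1 *ᵥ z)
    rw [Matrix.mulVec_mulVec, transpose_mul_coe_self, Matrix.one_mulVec] at h3
    rw [← h3, hpq, map_sum, Finset.sum_map]
    refine Finset.sum_congr rfl fun β _ => ?_
    rw [smul_eval, eval_hermiteMv, Function.Embedding.coeFn_mk, hcoeff]

end Expansion

/-! ### Linear combinations of Hermite products -/

section HermiteSum

open scoped Matrix

variable {P : ℕ}

/-- The linear combination `∑ S ∈ s, b S * hermiteProd S y`. -/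
noncomputable def hermiteSum (s : Finset (Fin P → ℕ)) (b : (Fin P → ℕ) → ℝ) (y : Fin P → ℝ) : ℝ :=
  ∑ S ∈ s, b S * hermiteProd S y

theorem continuous_hermiteSum (s : Finset (Fin P → ℕ)) (b : (Fin P → ℕ) → ℝ) :
    Continuous (hermiteSum s b) := by
  unfold hermiteSum
  exact continuous_finsetSum _ fun S _ => continuous_const.mul (continuous_hermiteProd S)

theorem memLp_hermiteProd (S : Fin P → ℕ) : MemLp (hermiteProd S) 2 (gauss (Fin P)) :=
  memLp_hermiteProdAll S

theorem memLp_hermiteSum (s : Finset (Fin P → ℕ)) (b : (Fin P → ℕ) → ℝ) :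
    MemLp (hermiteSum s b) 2 (gauss (Fin P)) := by
  unfold hermiteSum
  exact memLp_finsetSum _ fun S _ => (memLp_hermiteProd S).const_mul _

theorem integral_hermiteProd_self (S : Fin P → ℕ) :
    ∫ y, hermiteProd S y * hermiteProd S y ∂(gauss (Fin P)) = ∏ i, ((S i).factorial : ℝ) := by
  rw [integral_hermiteProd_mul, gaussExp_hermiteMv_self]

theorem integral_hermiteSum_mul (s t : Finset (Fin P → ℕ)) (b : (Fin P → ℕ) → ℝ) :
    ∫ y, hermiteSum s b y * hermiteSum t b y ∂(gauss (Fin P)) =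
      ∑ S ∈ s ∩ t, b S ^ 2 * ∏ i, ((S i).factorial : ℝ) := by
  have h1 : ∀ y, hermiteSum s b y * hermiteSum t b y =
      ∑ S ∈ s, ∑ T ∈ t, b S * b T * (hermiteProd S y * hermiteProd T y) := by
    intro y
    rw [hermiteSum, hermiteSum, Finset.sum_mul_sum]
    exact Finset.sum_congr rfl fun S _ => Finset.sum_congr rfl fun T _ => by ring
  have hint : ∀ S T : Fin P → ℕ, Integrable (fun y => b S * b T * (hermiteProd S y *
      hermiteProd T y)) (gauss (Fin P)) := fun S T =>
    ((memLp_hermiteProd S).integrable_mul (memLp_hermiteProd T)).const_mul _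
  simp_rw [h1]
  rw [integral_finsetSum _ fun S _ => integrable_finsetSum _ fun T _ => hint S T,
    ← Finset.filter_mem_eq_inter, Finset.sum_filter]
  refine Finset.sum_congr rfl fun S _ => ?_
  rw [integral_finsetSum _ fun T _ => hint S T]
  have h2 : ∀ T, ∫ y, b S * b T * (hermiteProd S y * hermiteProd T y) ∂(gauss (Fin P)) =
      if T = S then b S ^ 2 * ∏ i, ((S i).factorial : ℝ) else 0 := by
    intro T
    rw [integral_const_mul]
    split_ifs with h
    · rw [h, integral_hermiteProd_self]; ring
    · rw [integral_hermiteProd_mul, gaussExp_hermiteMv_of_ne (Ne.symm h), mul_zero]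
  simp_rw [h2]
  rw [Finset.sum_ite_eq']

theorem integral_comp_mulVec_of_mul_transpose {d : ℕ} {N : Matrix (Fin P) (Fin d) ℝ}
    (hN : N * Nᵀ = 1) {F : (Fin P → ℝ) → ℝ} (hF : Continuous F) :
    ∫ x, F (N *ᵥ x) ∂(gauss (Fin d)) = ∫ y, F y ∂(gauss (Fin P)) := by
  have h := measurePreserving_mulVec_gauss hN
  rw [← h.map_eq, integral_map h.measurable.aemeasurable hF.aestronglyMeasurable]

theorem hermiteProd_congr {S : Fin P → ℕ} {J : Finset (Fin P)} (hS : ∀ k ∉ J, S k = 0)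
    {y z : Fin P → ℝ} (h : ∀ k ∈ J, y k = z k) : hermiteProd S y = hermiteProd S z := by
  unfold hermiteProd
  refine Finset.prod_congr rfl fun k _ => ?_
  by_cases hk : k ∈ J
  · rw [h k hk]
  · rw [hS k hk]; simp

theorem hermiteSum_mulVec_congr {d : ℕ} {s : Finset (Fin P → ℕ)} {b : (Fin P → ℕ) → ℝ}
    {J : Finset (Fin P)} (hs : ∀ S ∈ s, ∀ k ∉ J, S k = 0) {N N' : Matrix (Fin P) (Fin d) ℝ}
    (h : ∀ k ∈ J, N k = N' k) (x : Fin d → ℝ) :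
    hermiteSum s b (N *ᵥ x) = hermiteSum s b (N' *ᵥ x) := by
  unfold hermiteSum
  refine Finset.sum_congr rfl fun S hS => ?_
  rw [hermiteProd_congr (hs S hS) fun k hk => ?_]
  simp only [Matrix.mulVec, h k hk]

theorem exists_setLIntegral_sq_integral_hermiteSum_le {s : Finset (Fin P → ℕ)}
    (b : (Fin P → ℕ) → ℝ) {J : Finset (Fin P)} {ℓ : ℕ} (hℓ : 1 ≤ ℓ)
    (hs : ∀ S ∈ s, ℓ ≤ ∑ j : {j // j ∉ J}, S j) :
    ∃ C : ℝ, 0 ≤ C ∧ ∀ (d : ℕ) (hPd : P ≤ d) (G : Set (Matrix.orthogonalGroup (Fin d) ℝ)),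
      MeasurableSet G →
      (∀ R R' : Matrix.orthogonalGroup (Fin d) ℝ, (∀ j ∈ J, firstRows hPd R j = firstRows hPd R' j)
        → (R ∈ G ↔ R' ∈ G)) →
      ∀ φ : (Fin d → ℝ) → ℝ, Measurable φ → MemLp φ 2 (gauss (Fin d)) →
      ∫⁻ R in G, ENNReal.ofReal ((∫ x, φ x * hermiteSum s b (firstRows hPd R *ᵥ x)
        ∂(gauss (Fin d))) ^ 2) ∂(haarOrthogonal d) ≤
      ENNReal.ofReal (C * (d : ℝ) ^ (-(ℓ : ℝ) / 2) * ∫ x, φ x ^ 2 ∂(gauss (Fin d))) *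
        haarOrthogonal d G := by
  choose! C hC h using fun (S : Fin P → ℕ) (hS : S ∈ s) =>
    exists_setLIntegral_sq_integral_hermiteProd_le S J hℓ (hs S hS)
  refine ⟨∑ S ∈ s, (s.card * b S ^ 2) * C S, Finset.sum_nonneg fun S hS =>
    mul_nonneg (by positivity) (hC S hS), fun d hPd G hG hGJ φ hφm hφ => ?_⟩
  have hI0 : 0 ≤ ∫ x, φ x ^ 2 ∂(gauss (Fin d)) := integral_nonneg fun x => sq_nonneg _
  have hq : ∀ R : Matrix.orthogonalGroup (Fin d) ℝ,
      ∫ x, φ x * hermiteSum s b (firstRows hPd R *ᵥ x) ∂(gauss (Fin d)) =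
      ∑ S ∈ s, b S * ∫ x, φ x * hermiteProd S (firstRows hPd R *ᵥ x) ∂(gauss (Fin d)) := by
    intro R
    simp_rw [hermiteSum, Finset.mul_sum, mul_left_comm _ (b _), ← integral_const_mul]
    refine integral_finsetSum _ fun S _ => Integrable.const_mul ?_ _
    exact hφ.integrable_mul ((memLp_hermiteProd S).comp_measurePreserving
      (measurePreserving_mulVec_gauss (firstRows_mul_transpose hPd R)))
  calc _ ≤ ∫⁻ R in G, ∑ S ∈ s, ENNReal.ofReal (s.card * b S ^ 2) * ENNReal.ofReal
        ((∫ x, φ x * hermiteProd S (firstRows hPd R *ᵥ x) ∂(gauss (Fin d))) ^ 2)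
        ∂(haarOrthogonal d) := by
        refine lintegral_mono fun R => ?_
        simp_rw [← ENNReal.ofReal_mul (show (0 : ℝ) ≤ s.card * b _ ^ 2 by positivity)]
        rw [← ENNReal.ofReal_sum_of_nonneg fun S _ => by positivity, hq R]
        refine ENNReal.ofReal_le_ofReal (sq_sum_le_card_mul_sum_sq.trans (le_of_eq ?_))
        rw [Finset.mul_sum]
        exact Finset.sum_congr rfl fun S _ => by ring
    _ = ∑ S ∈ s, ENNReal.ofReal (s.card * b S ^ 2) * ∫⁻ R in G, ENNReal.ofReal
        ((∫ x, φ x * hermiteProd S (firstRows hPd R *ᵥ x) ∂(gauss (Fin d))) ^ 2)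
        ∂(haarOrthogonal d) := by
        rw [lintegral_finsetSum]
        · exact Finset.sum_congr rfl fun S _ => lintegral_const_mul' _ _ ENNReal.ofReal_ne_top
        · intro S _
          exact ((((measurable_integral_mul_comp_mulVec hφm (continuous_hermiteProd S)).comp
            (measurable_firstRows hPd)).pow_const 2).ennreal_ofReal).const_mul _
    _ ≤ ∑ S ∈ s, ENNReal.ofReal (s.card * b S ^ 2) * (ENNReal.ofReal
        (C S * (d : ℝ) ^ (-(ℓ : ℝ) / 2) * ∫ x, φ x ^ 2 ∂(gauss (Fin d))) *
          haarOrthogonal d G) := by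
        gcongr with S hS
        exact h S hS d hPd G hG hGJ φ hφm hφ
    _ = _ := by
        simp_rw [← mul_assoc]
        rw [← Finset.sum_mul]
        congr 1
        rw [Finset.sum_mul, Finset.sum_mul, ENNReal.ofReal_sum_of_nonneg]
        · refine Finset.sum_congr rfl fun S hS => ?_
          rw [← ENNReal.ofReal_mul (by positivity)]
          congr 1; ring
        · intro S hS
          have := hC S hS
          positivity

end HermiteSum

/-! ### Rounded transcripts -/

/-- Each response is determined by the earlier ones. Existence here and uniqueness below make the
rounding cells a partition. -/
theorem exists_adaptive_sequence {n : ℕ} {α : Type*} (F : (t : Fin n) → (Fin t → α) → α) :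
    ∃ k : Fin n → α, ∀ t, k t = F t fun s => k (Fin.castLE t.isLt.le s) := by
  let k : Fin n → α := IsWellFounded.fix (· < ·) fun t ih =>
    F t fun s => ih (Fin.castLE t.isLt.le s) (by rw [Fin.lt_def]; exact s.2)
  exact ⟨k, fun t => IsWellFounded.fix_eq _ _ t⟩

theorem adaptive_sequence_unique {n : ℕ} {α : Type*} {F : (t : Fin n) → (Fin t → α) → α}
    {k k' : Fin n → α} (hk : ∀ t, k t = F t fun s => k (Fin.castLE t.isLt.le s))
    (hk' : ∀ t, k' t = F t fun s => k' (Fin.castLE t.isLt.le s)) : k = k' := by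
  ext t
  induction t using WellFoundedLT.induction with
  | _ t ih =>
    rw [hk, hk']
    congr 1
    ext s
    exact ih _ (by rw [Fin.lt_def]; exact s.2)

/-! ### The lower bound for CSQ algorithms -/

section LowerBound

open scoped Matrix

variable {P d n : ℕ}

/-- The query number `t` when the earlier responses are `τ` times the integers `k`. -/
noncomputable def CSQAlgorithm.roundedQuery (A : CSQAlgorithm d n) (τ : ℝ) (k : Fin n → ℤ)
    (t : Fin n) : (Fin d → ℝ) → ℝ :=
  A.query t fun s => τ * k (Fin.castLE t.isLt.le s)

/-- The matrices `N` for which rounding `E[φ · f(N x)]` to the grid `τ ℤ` produces the responses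
`τ k`. -/
def CSQAlgorithm.roundingCell (A : CSQAlgorithm d n) (τ : ℝ) (f : (Fin P → ℝ) → ℝ)
    (k : Fin n → ℤ) : Set (Matrix (Fin P) (Fin d) ℝ) :=
  {N | ∀ t, k t = round ((∫ x, A.roundedQuery τ k t x * f (N *ᵥ x) ∂(gauss (Fin d))) / τ)}

theorem CSQAlgorithm.measurable_roundedQuery (A : CSQAlgorithm d n) (τ : ℝ) (k : Fin n → ℤ)
    (t : Fin n) : Measurable (A.roundedQuery τ k t) := A.query_measurable _ _

theorem CSQAlgorithm.abs_roundedQuery_le (A : CSQAlgorithm d n) (τ : ℝ) (k : Fin n → ℤ)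
    (t : Fin n) (x : Fin d → ℝ) : |A.roundedQuery τ k t x| ≤ 1 :=
  abs_le.2 (A.query_bounded _ _ _)

theorem CSQAlgorithm.memLp_roundedQuery (A : CSQAlgorithm d n) (τ : ℝ) (k : Fin n → ℤ)
    (t : Fin n) : MemLp (A.roundedQuery τ k t) 2 (gauss (Fin d)) :=
  MemLp.of_bound (A.measurable_roundedQuery τ k t).aestronglyMeasurable 1
    (ae_of_all _ fun x => by rw [Real.norm_eq_abs]; exact A.abs_roundedQuery_le τ k t x)

theorem CSQAlgorithm.integral_roundedQuery_sq_le (A : CSQAlgorithm d n) (τ : ℝ) (k : Fin n → ℤ)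
    (t : Fin n) : ∫ x, A.roundedQuery τ k t x ^ 2 ∂(gauss (Fin d)) ≤ 1 := by
  calc _ ≤ ∫ _x, (1 : ℝ) ∂(gauss (Fin d)) :=
        integral_mono (A.memLp_roundedQuery τ k t).integrable_sq (integrable_const _)
          fun x => (sq_le_one_iff_abs_le_one _).2 (A.abs_roundedQuery_le τ k t x)
    _ = 1 := by simp

theorem CSQAlgorithm.measurableSet_roundingCell (A : CSQAlgorithm d n) (τ : ℝ)
    {f : (Fin P → ℝ) → ℝ} (hf : Continuous f) (k : Fin n → ℤ) :
    MeasurableSet (A.roundingCell τ f k) := by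
  rw [CSQAlgorithm.roundingCell, Set.ofPred_forall]
  refine MeasurableSet.iInter fun t => ?_
  have hm : Measurable fun N : Matrix (Fin P) (Fin d) ℝ =>
      round ((∫ x, A.roundedQuery τ k t x * f (N *ᵥ x) ∂(gauss (Fin d))) / τ) := by
    simp only [round_eq]
    exact Int.measurable_floor.comp (((measurable_integral_mul_comp_mulVec
      (A.measurable_roundedQuery τ k t) hf).div_const τ).add_const _)
  exact measurableSet_eq_fun measurable_const hm

theorem CSQAlgorithm.exists_mem_roundingCell (A : CSQAlgorithm d n) (τ : ℝ)
    (f : (Fin P → ℝ) → ℝ) (N : Matrix (Fin P) (Fin d) ℝ) : ∃ k, N ∈ A.roundingCell τ f k :=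
  exists_adaptive_sequence fun (t : Fin n) (w : Fin t → ℤ) =>
    round ((∫ x, A.query t (fun s => τ * w s) x * f (N *ᵥ x) ∂(gauss (Fin d))) / τ)

theorem CSQAlgorithm.disjoint_roundingCell (A : CSQAlgorithm d n) (τ : ℝ)
    (f : (Fin P → ℝ) → ℝ) {k k' : Fin n → ℤ} (hk : k ≠ k') :
    Disjoint (A.roundingCell τ f k) (A.roundingCell τ f k') := by
  rw [Set.disjoint_left]
  intro N h h'
  exact hk (adaptive_sequence_unique (F := fun (t : Fin n) (w : Fin t → ℤ) =>
    round ((∫ x, A.query t (fun s => τ * w s) x * f (N *ᵥ x) ∂(gauss (Fin d))) / τ)) h h')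

/-- The tolerance is split in two: rounding moves the correlation with f₁ by at most τ/2, and f₂
adds at most τ/2. -/
theorem CSQAlgorithm.isTranscript_rounded (A : CSQAlgorithm d n) {τ : ℝ} (hτ : 0 < τ)
    {f₁ f₂ : (Fin P → ℝ) → ℝ} (N : Matrix (Fin P) (Fin d) ℝ)
    (hf₁ : MemLp (fun x => f₁ (N *ᵥ x)) 2 (gauss (Fin d)))
    (hf₂ : MemLp (fun x => f₂ (N *ᵥ x)) 2 (gauss (Fin d)))
    {k : Fin n → ℤ} (hk : N ∈ A.roundingCell τ f₁ k)
    (h : ∀ t, |∫ x, A.roundedQuery τ k t x * f₂ (N *ᵥ x) ∂(gauss (Fin d))| ≤ τ / 2) :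
    A.IsTranscript τ (fun x => f₁ (N *ᵥ x) + f₂ (N *ᵥ x)) fun t => τ * k t := by
  intro t
  have h1 : ∫ x, A.roundedQuery τ k t x * (f₁ (N *ᵥ x) + f₂ (N *ᵥ x)) ∂(gauss (Fin d)) =
      ∫ x, A.roundedQuery τ k t x * f₁ (N *ᵥ x) ∂(gauss (Fin d)) +
      ∫ x, A.roundedQuery τ k t x * f₂ (N *ᵥ x) ∂(gauss (Fin d)) := by
    simp only [mul_add]
    exact integral_add ((A.memLp_roundedQuery τ k t).integrable_mul hf₁)
      ((A.memLp_roundedQuery τ k t).integrable_mul hf₂)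
  change |τ * (k t : ℝ) - ∫ x, A.roundedQuery τ k t x * (f₁ (N *ᵥ x) + f₂ (N *ᵥ x))
    ∂(gauss (Fin d))| ≤ τ
  set q₁ := ∫ x, A.roundedQuery τ k t x * f₁ (N *ᵥ x) ∂(gauss (Fin d)) with hq₁
  have h2 : |τ * (k t : ℝ) - q₁| ≤ τ / 2 := by
    have h3 := abs_sub_round (q₁ / τ)
    rw [← hk t, abs_sub_comm] at h3
    have h4 : τ * (k t : ℝ) - q₁ = τ * ((k t : ℝ) - q₁ / τ) := by field_simp
    rw [h4, abs_mul, abs_of_pos hτ]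
    nlinarith
  rw [h1, ← sub_sub]
  exact (abs_sub _ _).trans (by linarith [h t])

/-- Expanding around f₁ - g, the f₁f₂ term vanishes, ‖f₂‖² survives, and the cross term with g takes
away at most half of it. -/
theorem half_le_integral_sq_sub {Ω : Type*} [MeasurableSpace Ω] {μ : Measure Ω}
    {f₁ f₂ g : Ω → ℝ} (hf₁ : MemLp f₁ 2 μ) (hf₂ : MemLp f₂ 2 μ) (hg : MemLp g 2 μ)
    (horth : ∫ x, f₁ x * f₂ x ∂μ = 0)
    (h : |∫ x, g x * f₂ x ∂μ| ≤ (∫ x, f₂ x ^ 2 ∂μ) / 4) :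
    (∫ x, f₂ x ^ 2 ∂μ) / 2 ≤ ∫ x, (f₁ x + f₂ x - g x) ^ 2 ∂μ := by
  have h1 : ∫ x, (f₁ x + f₂ x - g x) ^ 2 ∂μ = ∫ x, (f₁ x - g x) ^ 2 ∂μ +
      2 * ∫ x, f₁ x * f₂ x ∂μ - 2 * ∫ x, g x * f₂ x ∂μ + ∫ x, f₂ x ^ 2 ∂μ := by
    have i1 : Integrable (fun x => (f₁ x - g x) ^ 2) μ := (hf₁.sub hg).integrable_sq
    have i2 : Integrable (fun x => 2 * (f₁ x * f₂ x)) μ := (hf₁.integrable_mul hf₂).const_mul 2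
    have i3 : Integrable (fun x => 2 * (g x * f₂ x)) μ := (hg.integrable_mul hf₂).const_mul 2
    have i4 : Integrable (fun x => (f₁ x - g x) ^ 2 + 2 * (f₁ x * f₂ x)) μ := i1.add i2
    have i5 : Integrable (fun x => (f₁ x - g x) ^ 2 + 2 * (f₁ x * f₂ x) - 2 * (g x * f₂ x)) μ :=
      i4.sub i3
    rw [← integral_const_mul, ← integral_const_mul, ← integral_add i1 i2, ← integral_sub i4 i3,
      ← integral_add i5 hf₂.integrable_sq]
    refine integral_congr_ae (ae_of_all _ fun x => ?_)
    simp only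
    ring
  have h2 : 0 ≤ ∫ x, (f₁ x - g x) ^ 2 ∂μ := integral_nonneg fun x => sq_nonneg _
  have h3 := (abs_le.1 h).2
  rw [h1, horth]
  linarith

/-- An output is only assumed measurable; a finite error is what makes it square-integrable. -/
theorem memLp_of_sqError_lt_top {f g : (Fin d → ℝ) → ℝ} (hf : MemLp f 2 (gauss (Fin d)))
    (hg : Measurable g) (h : sqError f g < ⊤) :
    MemLp g 2 (gauss (Fin d)) ∧
      sqError f g = ENNReal.ofReal (∫ x, (f x - g x) ^ 2 ∂(gauss (Fin d))) := by
  have hm : AEStronglyMeasurable (fun x => f x - g x) (gauss (Fin d)) :=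
    hf.1.sub hg.aestronglyMeasurable
  have hint : Integrable (fun x => (f x - g x) ^ 2) (gauss (Fin d)) := by
    refine ⟨hm.pow 2, ?_⟩
    rw [hasFiniteIntegral_iff_ofReal (ae_of_all _ fun x => sq_nonneg _)]
    exact h
  have hfg : MemLp (fun x => f x - g x) 2 (gauss (Fin d)) :=
    (memLp_two_iff_integrable_sq hm).2 hint
  refine ⟨?_, ?_⟩
  · have := hf.sub hfg
    convert this using 1
    ext x; simp
  · rw [ofReal_integral_eq_lintegral_ofReal hint (ae_of_all _ fun x => sq_nonneg _)]
    rfl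

theorem integral_sq_le_of_sub {Ω : Type*} [MeasurableSpace Ω] {μ : Measure Ω}
    {f g : Ω → ℝ} (hf : MemLp f 2 μ) (hg : MemLp g 2 μ) :
    ∫ x, g x ^ 2 ∂μ ≤ 2 * ∫ x, f x ^ 2 ∂μ + 2 * ∫ x, (f x - g x) ^ 2 ∂μ := by
  have i1 : Integrable (fun x => (f x - g x) ^ 2) μ := (hf.sub hg).integrable_sq
  rw [← integral_const_mul, ← integral_const_mul,
    ← integral_add (hf.integrable_sq.const_mul 2) (i1.const_mul 2)]
  refine integral_mono hg.integrable_sq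
    ((hf.integrable_sq.const_mul 2).add (i1.const_mul 2)) fun x => ?_
  simp only
  nlinarith [sq_nonneg (2 * f x - g x)]

/-- The matrices at which `φ` correlates with `f(N x)` beyond `ε`. -/
def correlationSet (f : (Fin P → ℝ) → ℝ) (φ : (Fin d → ℝ) → ℝ) (ε : ℝ) :
    Set (Matrix (Fin P) (Fin d) ℝ) :=
  {N | ε < |∫ x, φ x * f (N *ᵥ x) ∂(gauss (Fin d))|}

theorem measurableSet_correlationSet {f : (Fin P → ℝ) → ℝ} (hf : Continuous f)
    {φ : (Fin d → ℝ) → ℝ} (hφ : Measurable φ) (ε : ℝ) :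
    MeasurableSet (correlationSet f φ ε) :=
  measurableSet_lt measurable_const (measurable_integral_mul_comp_mulVec hφ hf).abs

/-- Markov's inequality for the squared correlation, restricted to G. -/
theorem measure_inter_correlationSet_le (hPd : P ≤ d) {f : (Fin P → ℝ) → ℝ} (hf : Continuous f)
    {φ : (Fin d → ℝ) → ℝ} (hφ : Measurable φ) {ε : ℝ} (hε : 0 < ε)
    {G : Set (Matrix.orthogonalGroup (Fin d) ℝ)} {B : ℝ}
    (h : ∫⁻ R in G, ENNReal.ofReal ((∫ x, φ x * f (firstRows hPd R *ᵥ x)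
      ∂(gauss (Fin d))) ^ 2) ∂(haarOrthogonal d) ≤ ENNReal.ofReal B * haarOrthogonal d G) :
    haarOrthogonal d (G ∩ firstRows hPd ⁻¹' correlationSet f φ ε) ≤
      ENNReal.ofReal (B / ε ^ 2) * haarOrthogonal d G := by
  have hm : Measurable fun R : Matrix.orthogonalGroup (Fin d) ℝ =>
      ENNReal.ofReal ((∫ x, φ x * f (firstRows hPd R *ᵥ x) ∂(gauss (Fin d))) ^ 2) :=
    (((measurable_integral_mul_comp_mulVec hφ hf).comp
      (measurable_firstRows hPd)).pow_const 2).ennreal_ofReal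
  have hset : MeasurableSet (firstRows hPd ⁻¹' correlationSet f φ ε) :=
    measurable_firstRows hPd (measurableSet_correlationSet hf hφ ε)
  have h0 : ENNReal.ofReal (ε ^ 2) ≠ 0 := (ENNReal.ofReal_pos.2 (by positivity)).ne'
  have h1 := meas_ge_le_lintegral_div (μ := (haarOrthogonal d).restrict G) hm.aemeasurable h0
    ENNReal.ofReal_ne_top
  rw [Set.inter_comm, ← Measure.restrict_apply hset]
  calc _ ≤ _ := measure_mono fun R hR => ?_
    _ ≤ _ := h1
    _ ≤ ENNReal.ofReal B * haarOrthogonal d G / ENNReal.ofReal (ε ^ 2) := by gcongr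
    _ = _ := by
        rw [ENNReal.ofReal_div_of_pos (by positivity), ENNReal.div_eq_inv_mul,
          ENNReal.div_eq_inv_mul, mul_assoc]
  · have hR' : ε < |∫ x, φ x * f (firstRows hPd R *ᵥ x) ∂(gauss (Fin d))| := hR
    refine ENNReal.ofReal_le_ofReal ?_
    rw [← sq_abs (∫ x, φ x * f (firstRows hPd R *ᵥ x) ∂(gauss (Fin d)))]
    exact pow_le_pow_left₀ hε.le hR'.le 2

end LowerBound

/-! ### From success of the algorithm to rare correlations -/

section LowerBoundMain

open scoped Matrix

variable {P d n : ℕ}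

/-- The queries and the output that must be ruled out on the rounding cell `k`. -/
def CSQAlgorithm.exceptionalSet (A : CSQAlgorithm d n) (τ : ℝ) (f₁ f₂ : (Fin P → ℝ) → ℝ)
    (a ε : ℝ) (k : Fin n → ℤ) : Set (Matrix (Fin P) (Fin d) ℝ) :=
  A.roundingCell τ f₁ k ∩ ((⋃ t, correlationSet f₂ (A.roundedQuery τ k t) (τ / 2)) ∪
    {N | N ∈ correlationSet f₂ (A.output fun t => τ * k t) ε ∧
      MemLp (A.output fun t => τ * k t) 2 (gauss (Fin d)) ∧
      ∫ x, A.output (fun t => τ * k t) x ^ 2 ∂(gauss (Fin d)) ≤ a})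

theorem CSQAlgorithm.measurableSet_exceptionalSet (A : CSQAlgorithm d n) (τ : ℝ)
    {f₁ f₂ : (Fin P → ℝ) → ℝ} (hf₁ : Continuous f₁) (hf₂ : Continuous f₂) (a ε : ℝ)
    (k : Fin n → ℤ) : MeasurableSet (A.exceptionalSet τ f₁ f₂ a ε k) := by
  refine (A.measurableSet_roundingCell τ hf₁ k).inter (MeasurableSet.union
    (MeasurableSet.iUnion fun t =>
      measurableSet_correlationSet hf₂ (A.measurable_roundedQuery τ k t) _) ?_)
  -- The conditions on the norm of the output do not involve N.
  exact (measurableSet_correlationSet hf₂ (A.output_measurable _) _).inter (MeasurableSet.const _)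

/-- If no query correlates with f₂, the rounded responses are admissible, so the output must succeed
on them; by `half_le_integral_sq_sub` it then correlates with f₂. Success also bounds the norm of
the output, by the triangle inequality in squared form. -/
theorem CSQAlgorithm.mem_exceptionalSet_of_learnsBelow (A : CSQAlgorithm d n) {τ : ℝ} (hτ : 0 < τ)
    {f₁ f₂ : (Fin P → ℝ) → ℝ} (hc₁ : Continuous f₁) (hc₂ : Continuous f₂)
    (hf₁ : MemLp f₁ 2 (gauss (Fin P))) (hf₂ : MemLp f₂ 2 (gauss (Fin P)))
    (horth : ∫ y, f₁ y * f₂ y ∂(gauss (Fin P)) = 0)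
    {N : Matrix (Fin P) (Fin d) ℝ} (hN : N * Nᵀ = 1) {a : ℝ}
    (ha : 2 * ∫ y, (f₁ y + f₂ y) ^ 2 ∂(gauss (Fin P)) + ∫ y, f₂ y ^ 2 ∂(gauss (Fin P)) ≤ a)
    (hA : A.LearnsBelow τ (fun x => f₁ (N *ᵥ x) + f₂ (N *ᵥ x))
      ((∫ y, f₂ y ^ 2 ∂(gauss (Fin P))) / 2)) :
    N ∈ ⋃ k, A.exceptionalSet τ f₁ f₂ a ((∫ y, f₂ y ^ 2 ∂(gauss (Fin P))) / 4) k := by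
  obtain ⟨k, hk⟩ := A.exists_mem_roundingCell τ f₁ N
  have hp := measurePreserving_mulVec_gauss hN
  have hg₁ : MemLp (fun x => f₁ (N *ᵥ x)) 2 (gauss (Fin d)) := hf₁.comp_measurePreserving hp
  have hg₂ : MemLp (fun x => f₂ (N *ᵥ x)) 2 (gauss (Fin d)) := hf₂.comp_measurePreserving hp
  have e1 : ∫ x, f₁ (N *ᵥ x) * f₂ (N *ᵥ x) ∂(gauss (Fin d)) = 0 :=
    (integral_comp_mulVec_of_mul_transpose hN (hc₁.mul hc₂)).trans horth
  have e2 : ∫ x, f₂ (N *ᵥ x) ^ 2 ∂(gauss (Fin d)) = ∫ y, f₂ y ^ 2 ∂(gauss (Fin P)) :=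
    integral_comp_mulVec_of_mul_transpose hN (hc₂.pow 2)
  have e3 : ∫ x, (f₁ (N *ᵥ x) + f₂ (N *ᵥ x)) ^ 2 ∂(gauss (Fin d)) =
      ∫ y, (f₁ y + f₂ y) ^ 2 ∂(gauss (Fin P)) :=
    integral_comp_mulVec_of_mul_transpose hN ((hc₁.add hc₂).pow 2)
  refine Set.mem_iUnion.2 ⟨k, hk, ?_⟩
  by_cases hq : ∃ t, N ∈ correlationSet f₂ (A.roundedQuery τ k t) (τ / 2)
  · exact Or.inl (Set.mem_iUnion.2 hq)
  right
  have ht := A.isTranscript_rounded hτ N hg₁ hg₂ hk fun t => by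
    by_contra h
    exact hq ⟨t, not_le.1 h⟩
  have herr := hA _ ht
  have hg : MemLp (fun x => f₁ (N *ᵥ x) + f₂ (N *ᵥ x)) 2 (gauss (Fin d)) := hg₁.add hg₂
  obtain ⟨hout, herr'⟩ := memLp_of_sqError_lt_top hg (A.output_measurable fun t => τ * k t)
    (herr.trans ENNReal.ofReal_lt_top)
  have hlt := (ENNReal.ofReal_lt_ofReal_iff' .. ).1 (herr' ▸ herr)
  refine ⟨?_, hout, ?_⟩
  · by_contra hno
    have h1 := half_le_integral_sq_sub hg₁ hg₂ hout e1 (by rw [e2]; exact not_lt.1 hno)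
    rw [e2] at h1
    exact absurd hlt.1 (not_lt.2 h1)
  · have h2 := integral_sq_le_of_sub hg hout
    rw [e3] at h2
    linarith [hlt.1]

/-- On one cell the n queries and the output are fixed functions, and the cell depends only on the
rows in J because f₁ does. The bound on each cell is proportional to the mass of the cell, so the
sum over all cells is at most the constant. -/
theorem CSQAlgorithm.measure_iUnion_exceptionalSet_le (A : CSQAlgorithm d n) (hPd : P ≤ d)
    {τ : ℝ} (hτ : 0 < τ) {f₁ f₂ : (Fin P → ℝ) → ℝ} (hc₁ : Continuous f₁) (hc₂ : Continuous f₂)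
    {a ε B : ℝ} (ha : 0 ≤ a) (hε : 0 < ε) (hB : 0 ≤ B) {J : Finset (Fin P)}
    (hJ : ∀ N N' : Matrix (Fin P) (Fin d) ℝ, (∀ j ∈ J, N j = N' j) →
      ∀ x, f₁ (N *ᵥ x) = f₁ (N' *ᵥ x))
    (h : ∀ G : Set (Matrix.orthogonalGroup (Fin d) ℝ), MeasurableSet G →
      (∀ R R' : Matrix.orthogonalGroup (Fin d) ℝ, (∀ j ∈ J, firstRows hPd R j = firstRows hPd R' j)
        → (R ∈ G ↔ R' ∈ G)) →
      ∀ φ : (Fin d → ℝ) → ℝ, Measurable φ → MemLp φ 2 (gauss (Fin d)) →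
      ∫⁻ R in G, ENNReal.ofReal ((∫ x, φ x * f₂ (firstRows hPd R *ᵥ x)
        ∂(gauss (Fin d))) ^ 2) ∂(haarOrthogonal d) ≤
      ENNReal.ofReal (B * ∫ x, φ x ^ 2 ∂(gauss (Fin d))) * haarOrthogonal d G) :
    haarOrthogonal d (firstRows hPd ⁻¹' ⋃ k, A.exceptionalSet τ f₁ f₂ a ε k) ≤
      ENNReal.ofReal (n * (B / (τ / 2) ^ 2) + B * a / ε ^ 2) := by
  set G : (Fin n → ℤ) → Set (Matrix.orthogonalGroup (Fin d) ℝ) :=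
    fun k => firstRows hPd ⁻¹' A.roundingCell τ f₁ k with hG
  have hGm : ∀ k, MeasurableSet (G k) := fun k =>
    measurable_firstRows hPd (A.measurableSet_roundingCell τ hc₁ k)
  have hGJ : ∀ k, ∀ R R' : Matrix.orthogonalGroup (Fin d) ℝ,
      (∀ j ∈ J, firstRows hPd R j = firstRows hPd R' j) → (R ∈ G k ↔ R' ∈ G k) := by
    intro k R R' hRR
    have := hJ _ _ hRR
    simp only [hG, Set.mem_preimage, CSQAlgorithm.roundingCell, Set.mem_ofPred_eq, this]
  have hGd : Pairwise (Function.onFun Disjoint G) := fun k k' hk =>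
    (A.disjoint_roundingCell τ f₁ hk).preimage _
  have hk : ∀ k, haarOrthogonal d (firstRows hPd ⁻¹' A.exceptionalSet τ f₁ f₂ a ε k) ≤
      ENNReal.ofReal (n * (B / (τ / 2) ^ 2) + B * a / ε ^ 2) * haarOrthogonal d (G k) := by
    intro k
    have h1 : ∀ t, haarOrthogonal d (G k ∩ firstRows hPd ⁻¹'
        correlationSet f₂ (A.roundedQuery τ k t) (τ / 2)) ≤
        ENNReal.ofReal (B / (τ / 2) ^ 2) * haarOrthogonal d (G k) := by
      intro t
      refine measure_inter_correlationSet_le hPd hc₂ (A.measurable_roundedQuery τ k t)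
        (by positivity) ((h (G k) (hGm k) (hGJ k) _ (A.measurable_roundedQuery τ k t)
          (A.memLp_roundedQuery τ k t)).trans ?_)
      gcongr
      exact mul_le_of_le_one_right hB (A.integral_roundedQuery_sq_le τ k t)
    set W : Set (Matrix (Fin P) (Fin d) ℝ) :=
      {N | N ∈ correlationSet f₂ (A.output fun t => τ * k t) ε ∧
      MemLp (A.output fun t => τ * k t) 2 (gauss (Fin d)) ∧
      ∫ x, A.output (fun t => τ * k t) x ^ 2 ∂(gauss (Fin d)) ≤ a} with hW
    have h2 : haarOrthogonal d (G k ∩ firstRows hPd ⁻¹' W) ≤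
        ENNReal.ofReal (B * a / ε ^ 2) * haarOrthogonal d (G k) := by
      by_cases hout : MemLp (A.output fun t => τ * k t) 2 (gauss (Fin d)) ∧
          ∫ x, A.output (fun t => τ * k t) x ^ 2 ∂(gauss (Fin d)) ≤ a
      · refine (measure_mono (Set.inter_subset_inter_right _ (Set.preimage_mono
          fun N hN => hN.1))).trans (measure_inter_correlationSet_le hPd hc₂
            (A.output_measurable fun t => τ * k t) hε
            ((h (G k) (hGm k) (hGJ k) _ (A.output_measurable _) hout.1).trans ?_))
        gcongr
        exact hout.2
      · have hemp : W = ∅ := Set.eq_empty_iff_forall_notMem.2 fun N hN => hout hN.2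
        rw [hemp]; simp
    have hsub : firstRows hPd ⁻¹' A.exceptionalSet τ f₁ f₂ a ε k ⊆
        (⋃ t, G k ∩ firstRows hPd ⁻¹' correlationSet f₂ (A.roundedQuery τ k t) (τ / 2)) ∪
        (G k ∩ firstRows hPd ⁻¹' W) := by
      rintro R ⟨hR1, hR2 | hR2⟩
      · obtain ⟨t, ht⟩ := Set.mem_iUnion.1 hR2
        exact Or.inl (Set.mem_iUnion.2 ⟨t, hR1, ht⟩)
      · exact Or.inr ⟨hR1, hR2⟩
    calc _ ≤ _ := measure_mono hsub
      _ ≤ _ := measure_union_le _ _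
      _ ≤ ∑ _t : Fin n, ENNReal.ofReal (B / (τ / 2) ^ 2) * haarOrthogonal d (G k) +
          ENNReal.ofReal (B * a / ε ^ 2) * haarOrthogonal d (G k) := by
          gcongr
          refine (measure_iUnion_fintype_le _ _).trans ?_
          exact Finset.sum_le_sum fun t _ => h1 t
      _ = _ := by
          rw [Finset.sum_const, Finset.card_univ, Fintype.card_fin, nsmul_eq_mul,
            ENNReal.ofReal_add (by positivity) (by positivity), add_mul,
            ENNReal.ofReal_mul (Nat.cast_nonneg n), ENNReal.ofReal_natCast, mul_assoc]
  rw [Set.preimage_iUnion]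
  calc _ ≤ ∑' k, haarOrthogonal d (firstRows hPd ⁻¹' A.exceptionalSet τ f₁ f₂ a ε k) :=
        measure_iUnion_le _
    _ ≤ ∑' k, ENNReal.ofReal (n * (B / (τ / 2) ^ 2) + B * a / ε ^ 2) * haarOrthogonal d (G k) :=
        ENNReal.tsum_le_tsum hk
    _ = ENNReal.ofReal (n * (B / (τ / 2) ^ 2) + B * a / ε ^ 2) * haarOrthogonal d (⋃ k, G k) := by
        rw [ENNReal.tsum_mul_left, measure_iUnion hGd hGm]
    _ ≤ _ := mul_le_of_le_one_right' prob_le_one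

/-- Rotating the target by `Q` amounts to rotating the rows of the semi-orthogonal matrix. -/
theorem uniformSemiorthogonal_setOf_le (hPd : P ≤ d) (Q : Matrix.orthogonalGroup (Fin P) ℝ)
    {E : Set (Matrix (Fin P) (Fin d) ℝ)} {T : Set (Matrix (Fin P) (Fin d) ℝ)}
    (hT : MeasurableSet T)
    (hE : ∀ M ∈ E, (Q.1 * M) * (Q.1 * M)ᵀ = 1 → Q.1 * M ∈ T) :
    uniformSemiorthogonal hPd E ≤ haarOrthogonal d (firstRows hPd ⁻¹' T) := by
  -- U = Q ⊕ 1 acts on the first P rows as Q, and Haar measure is invariant under it.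
  obtain ⟨U, hU⟩ : ∃ U : Matrix.orthogonalGroup (Fin d) ℝ,
      ∀ R, Q.1 * firstRows hPd R = firstRows hPd (U * R) := by
    let e : Fin d ≃ Fin P ⊕ Fin (d - P) :=
      (finCongr (by omega : d = P + (d - P))).trans finSumFinEquiv.symm
    refine ⟨blockOrthogonal e Q, fun R => ?_⟩
    ext i k
    have he : e.symm (Sum.inl i) = Fin.castLE hPd i := by ext; simp [e]
    have h0 : ∀ j, e.symm (Sum.inl j) = Fin.castLE hPd j := fun j => by ext; simp [e]
    have h1 := blockOrthogonal_mulVec_inl e Q (fun l => R.1 l k) i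
    rw [he] at h1
    simp only [h0] at h1
    exact h1.symm
  have hmeas : Measurable fun M : Matrix (Fin P) (Fin d) ℝ => Q.1 * M :=
    Continuous.measurable (by fun_prop)
  have hO : MeasurableSet {M : Matrix (Fin P) (Fin d) ℝ | (Q.1 * M) * (Q.1 * M)ᵀ = 1} :=
    (isClosed_eq (by fun_prop) continuous_const).measurableSet
  -- E need not be measurable, so it is enclosed in a measurable set; the added complement of the
  -- semi-orthogonal matrices is never hit by `firstRows`.
  calc uniformSemiorthogonal hPd E
      ≤ uniformSemiorthogonal hPd ((fun M => Q.1 * M) ⁻¹' T ∪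
          {M | (Q.1 * M) * (Q.1 * M)ᵀ = 1}ᶜ) := by
        refine measure_mono fun M hM => ?_
        by_cases h : (Q.1 * M) * (Q.1 * M)ᵀ = 1
        · exact Or.inl (hE M hM h)
        · exact Or.inr h
    _ ≤ haarOrthogonal d ((fun R => U * R) ⁻¹' (firstRows hPd ⁻¹' T)) := by
        rw [uniformSemiorthogonal, Measure.map_apply (measurable_firstRows hPd)
          ((hmeas hT).union hO.compl)]
        refine measure_mono fun R hR => ?_
        rcases hR with hR | hR
        · change firstRows hPd (U * R) ∈ T
          rw [← hU]; exact hR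
        · refine absurd ?_ hR
          change (Q.1 * firstRows hPd R) * (Q.1 * firstRows hPd R)ᵀ = 1
          rw [hU]; exact firstRows_mul_transpose hPd _
    _ = _ := measure_preimage_mul _ _ _

end LowerBoundMain

/-! ### Optimal axes and the final constants -/

section IsoLeap

open scoped Matrix

variable {P : ℕ}

/-- An unbounded supremum in ℕ is 0 by convention, so a positive `isoLeap` is bounded and attained.
-/
theorem exists_leap_eq_isoLeap {h : MvPolynomial (Fin P) ℝ} (hh : 1 ≤ isoLeap h) :
    ∃ Q, leap h Q = isoLeap h := by
  refine Nat.sSup_mem (Set.range_nonempty _) ?_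
  by_contra hb
  have h0 : isoLeap h = 0 := Nat.sSup_of_not_bddAbove hb
  omega

/-- In axes attaining the isotropic leap `ℓ`, a polynomial splits as `f₁ + f₂`, where `f₁` depends
on the coordinates in `J` only and all terms of `f₂` have degree at least `ℓ` outside `J`. -/
theorem exists_hermiteSum_decomposition {h : MvPolynomial (Fin P) ℝ} (hh : 1 ≤ isoLeap h) :
    ∃ (Q : Matrix.orthogonalGroup (Fin P) ℝ) (J : Finset (Fin P)) (s₁ s₂ : Finset (Fin P → ℕ))
      (b : (Fin P → ℕ) → ℝ), Disjoint s₁ s₂ ∧ s₂.Nonempty ∧ (∀ S ∈ s₂, b S ≠ 0) ∧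
      (∀ S ∈ s₁, ∀ k ∉ J, S k = 0) ∧ (∀ S ∈ s₂, isoLeap h ≤ ∑ k : {k // k ∉ J}, S k) ∧
      ∀ z, MvPolynomial.eval z h =
        hermiteSum s₁ b (Q.1 *ᵥ z) + hermiteSum s₂ b (Q.1 *ᵥ z) := by
  classical
  obtain ⟨Q, hQ⟩ := exists_leap_eq_isoLeap hh
  obtain ⟨s, hs, he⟩ := exists_hermite_expansion h Q
  rw [← hQ] at hh ⊢
  obtain ⟨J, hJ, S₀, hS₀, hS₀J⟩ := exists_coords_of_leapOf hh
  refine ⟨Q, J, {S ∈ s | ∀ k ∉ J, S k = 0}, {S ∈ s | ¬ ∀ k ∉ J, S k = 0}, hermiteCoeff h Q,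
    Finset.disjoint_filter_filter_not _ _ _, ⟨S₀, ?_⟩, ?_, ?_, ?_, ?_⟩
  · refine Finset.mem_filter.2 ⟨(hs S₀).2 hS₀, fun h0 => ?_⟩
    have : ∑ k : {k // k ∉ J}, S₀ k = 0 := Finset.sum_eq_zero fun k _ => h0 k k.2
    unfold leap at hh
    omega
  · exact fun S hS => (hs S).1 (Finset.mem_filter.1 hS).1
  · exact fun S hS => (Finset.mem_filter.1 hS).2
  · intro S hS
    obtain ⟨hS1, hS2⟩ := Finset.mem_filter.1 hS
    exact (hJ S ((hs S).1 hS1)).resolve_left hS2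
  · intro z
    rw [he, hermiteSum, hermiteSum, Finset.sum_filter_add_sum_filter_not]

theorem integral_hermiteSum_sq_pos {s : Finset (Fin P → ℕ)} {b : (Fin P → ℕ) → ℝ}
    (hs : s.Nonempty) (hb : ∀ S ∈ s, b S ≠ 0) :
    0 < ∫ y, hermiteSum s b y ^ 2 ∂(gauss (Fin P)) := by
  simp only [pow_two]
  rw [integral_hermiteSum_mul, Finset.inter_self]
  refine Finset.sum_pos (fun S hS => ?_) hs
  have := hb S hS
  exact mul_pos (by positivity) (Finset.prod_pos fun i _ => by positivity)

theorem exists_uniformSemiorthogonal_learnsBelow_le (h : MvPolynomial (Fin P) ℝ) :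
    ∃ c C : ℝ, 0 < c ∧ 0 < C ∧
      ∀ (d : ℕ) (hPd : P ≤ d) (n : ℕ) (τ : ℝ), 0 < τ → τ ^ 2 ≤ n →
        ∀ A : CSQAlgorithm d n,
          uniformSemiorthogonal hPd {M | A.LearnsBelow τ (multiIndexTarget h M) c} ≤
            ENNReal.ofReal (C * n / τ ^ 2 * (d : ℝ) ^ (-(isoLeap h : ℝ) / 2)) := by
  rcases Nat.eq_zero_or_pos (isoLeap h) with h0 | hpos
  -- At leap zero the claimed bound is n/τ² ≥ 1, which any probability satisfies.
  · refine ⟨1, 1, one_pos, one_pos, fun d hPd n τ hτ hτn A => prob_le_one.trans ?_⟩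
    rw [h0]
    simpa using (one_le_div (by positivity)).2 hτn
  obtain ⟨Q, J, s₁, s₂, b, hdisj, hne, hb, hs₁, hs₂, he⟩ := exists_hermiteSum_decomposition hpos
  obtain ⟨C, hC, hbound⟩ := exists_setLIntegral_sq_integral_hermiteSum_le b hpos hs₂
  set v : ℝ := ∫ y, hermiteSum s₂ b y ^ 2 ∂(gauss (Fin P)) with hv
  have hvpos : 0 < v := integral_hermiteSum_sq_pos hne hb
  set a : ℝ := 2 * ∫ y, (hermiteSum s₁ b y + hermiteSum s₂ b y) ^ 2 ∂(gauss (Fin P)) + v with ha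
  have ha0 : 0 ≤ a := by
    have : 0 ≤ ∫ y, (hermiteSum s₁ b y + hermiteSum s₂ b y) ^ 2 ∂(gauss (Fin P)) :=
      integral_nonneg fun y => sq_nonneg _
    positivity
  have horth : ∫ y, hermiteSum s₁ b y * hermiteSum s₂ b y ∂(gauss (Fin P)) = 0 := by
    rw [integral_hermiteSum_mul, Finset.disjoint_iff_inter_eq_empty.1 hdisj, Finset.sum_empty]
  -- 4C comes from Markov at τ/2 for each query, the second summand from Markov at v/4 for an output
  -- of squared norm at most a, and the 1 ensures positivity.
  refine ⟨v / 2, 4 * C + C * a / (v / 4) ^ 2 + 1, by positivity, by positivity,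
    fun d hPd n τ hτ hτn A => ?_⟩
  have hc₁ := continuous_hermiteSum s₁ b
  have hc₂ := continuous_hermiteSum s₂ b
  set p : ℝ := (d : ℝ) ^ (-(isoLeap h : ℝ) / 2) with hp
  have hp0 : 0 ≤ p := by positivity
  calc _ ≤ _ := uniformSemiorthogonal_setOf_le hPd Q
        (MeasurableSet.iUnion fun k => A.measurableSet_exceptionalSet τ hc₁ hc₂ a (v / 4) k) ?_
    _ ≤ ENNReal.ofReal (n * (C * p / (τ / 2) ^ 2) + C * p * a / (v / 4) ^ 2) :=
        A.measure_iUnion_exceptionalSet_le hPd hτ hc₁ hc₂ ha0 (by positivity) (by positivity)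
          (fun N N' hN x => hermiteSum_mulVec_congr hs₁ hN x) (hbound d hPd)
    _ ≤ _ := ENNReal.ofReal_le_ofReal ?_
  · intro M hM hO
    refine A.mem_exceptionalSet_of_learnsBelow hτ hc₁ hc₂ (memLp_hermiteSum s₁ b)
      (memLp_hermiteSum s₂ b) horth hO le_rfl ?_
    have hfun : multiIndexTarget h M = fun x =>
        hermiteSum s₁ b ((Q.1 * M) *ᵥ x) + hermiteSum s₂ b ((Q.1 * M) *ᵥ x) := by
      funext x
      rw [multiIndexTarget, he, Matrix.mulVec_mulVec]
    rw [← hfun]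
    exact hM
  -- The output term lacks the factor n/τ²; τ² ≤ n allows it to be inserted.
  · have h1 : 1 ≤ n / τ ^ 2 := (one_le_div (by positivity)).2 hτn
    have h2 : C * a / (v / 4) ^ 2 * p * 1 ≤ C * a / (v / 4) ^ 2 * p * (n / τ ^ 2) :=
      mul_le_mul_of_nonneg_left h1 (by positivity)
    have h3 : 0 ≤ p * (n / τ ^ 2) := by positivity
    calc n * (C * p / (τ / 2) ^ 2) + C * p * a / (v / 4) ^ 2
        = 4 * C * p * (n / τ ^ 2) + C * a / (v / 4) ^ 2 * p * 1 := by field_simp; ring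
      _ ≤ 4 * C * p * (n / τ ^ 2) + C * a / (v / 4) ^ 2 * p * (n / τ ^ 2) + p * (n / τ ^ 2) := by
          linarith
      _ = _ := by ring

end IsoLeap

theorem mainTheorem6 (P : ℕ) :
    (∀ h : MvPolynomial (Fin P) ℝ, 1 ≤ h.totalDegree →
      ∃ c C : ℝ, 0 < c ∧ 0 < C ∧
        ∀ (d : ℕ) (hPd : P ≤ d) (n : ℕ) (τ : ℝ), 0 < τ → τ ^ 2 ≤ n →
          ∀ A : CSQAlgorithm d n,
            uniformSemiorthogonal hPd {M | A.LearnsBelow τ (multiIndexTarget h M) c} ≤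
              ENNReal.ofReal (C * n / τ ^ 2 * (d : ℝ) ^ (-(isoLeap h : ℝ) / 2))) ∧
    (∀ α : Fin P → ℕ, ∃ C : ℝ, 0 < C ∧
      ∀ (d : ℕ) (hPd : P ≤ d) (φ : (Fin d → ℝ) → ℝ),
        MemLp φ 2 (stdGauss d) → ∫ x, φ x ^ 2 ∂(stdGauss d) = 1 →
          ∫⁻ R, ENNReal.ofReal
              ((∫ x, hermiteProd α ((firstRows hPd R).mulVec x) * φ x ∂(stdGauss d)) ^ 2)
              ∂(haarOrthogonal d) ≤
            ENNReal.ofReal (C * (d : ℝ) ^ (-(⌈((∑ i, α i : ℕ) : ℝ) / 2⌉₊ : ℝ)))) :=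
  ⟨fun h _ => exists_uniformSemiorthogonal_learnsBelow_le h,
    fun α => exists_lintegral_sq_integral_hermiteProd_le α⟩
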